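/- Let $d,p\in\mathbb N$, let $u_0\in C^2(\mathbb R^d;\mathbb R)$, $f(x,a)=f_0(x)+\mathbf c_f^{T}a$ with $f_0\in C^2(\mathbb R^d;\mathbb R^d)$ and $\mathbf c_f\in\mathbb R^{p\times d}$, and let $\ell\in C^2(\mathbb R^d\times\mathbb R^p;\mathbb R)$. Let $C_0,C_f,C_\ell$ and $\ell_0>0$ be constants such that, for all $x,x_1,x_2\in\mathbb R^d$ and $a,a_1,a_2\in\mathbb R^p$ (Euclidean norms for vectors, operator norms for matrices): (A0) $|\nabla u_0(x)|\le C_0(1+|x|)$ and $|D^2u_0(x)|\le C_0$; (A1) $|\mathbf c_f|\le C_f$, $|f(x,a)|\le C_f(1+|x|+|a|)$, $|D_xf(x,a)|\le C_f$, $D^2_{aa}\ell(x,a)\succeq \ell_0\,\mathbb I_p$, $|D_a\ell(x,a)|\ge \ell_0(|a|-1)$, $|\ell(x,a)|\le C_\ell(1+|x|^2+|a|^2)$, $|D_x\ell(x,a)|\le C_\ell(1+|x|+|a|)$; (A2) $\sum_{i=1}^d|D_x(\partial_{x_i}f(x,a))|\le \frac{C_f}{1+|x|}$, $|\ell(x_1,a_1)-\ell(x_2,a_2)|\le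 C_\ell\big(1+\max(|x_1|,|x_2|)+\max(|a_1|,|a_2|)\big)\big(|x_1-x_2|+|a_1-a_2|\big)$, and $|D^2_{xa}\ell(x,a)|,|D^2_{ax}\ell(x,a)|,|D^2_{xx}\ell(x,a)|\le C_\ell$. For $T>0$, consider the value-gradient policy iterates $(\lambda^{(k)},a^{(k)})_{k\ge0}$ on $\mathbb R^d\times[0,T]$: $\lambda^{(0)}(x,t)=\nabla u_0(x)$; for every $k\ge0$, $$a^{(k)}(x,t)=\arg\max_{a\in\mathbb R^p}\big(\lambda^{(k)}(x,t)\cdot(-f(x,a))-\ell(x,a)\big);$$ and $\lambda^{(k+1)}$ is a classical solution (continuous on $\mathbb R^d\times[0,T]$ and differentiable in $\mathbb R^d\times(0,T)$) of $$\partial_t\lambda^{(k+1)}=D\lambda^{(k+1)}\,f(x,a^{(k)})+\big(D_xf(x,a^{(k)})\big)^{T}\lambda^{(k)}+\nabla_x\ell(x,a^{(k)})\ \text{ in }\mathbb R^d\times(0,T),\qquad \lambda^{(k+1)}(x,0)=\nabla u_0(x).$$ For $\alpha\in(0,1)$, $\gamma>0$ and $k\ge1$ put $$e_k=\int_0^Te^{-\gamma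 t}\int_{\mathbb R^d}\frac{|\lambda^{(k)}(x,t)-\lambda^{(k-1)}(x,t)|^2}{(1+|x|^2)^{2\alpha}}\,dx\,dt\in[0,\infty].$$ Then there exist $T_0>0$ and $\gamma_0>0$, depending only on $d,p,C_0,C_f,C_\ell,\ell_0$, such that for all $\alpha\in(0,1)$, $0<T\le T_0$ and $\gamma\ge\gamma_0$, $$e_k\le 2^{-(k-1)}e_1\qquad\text{for all }k\ge1,$$ as an inequality in $[0,\infty]$. In particular, if $e_1<\infty$, then $e_k=\mathcal O(2^{-k})$ as $k\to\infty$. -/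

import Mathlib

open scoped ENNReal NNReal

namespace PILambda

/-- Euclidean space `ℝⁿ`. -/
abbrev E (n : ℕ) := EuclideanSpace ℝ (Fin n)

/-- The dynamics `f(x, a) = f₀(x) + c_fᵀ a`; the continuous linear map `c` is `a ↦ c_fᵀ a`, so that
`‖c‖` is the operator norm of the matrix `c_f`. -/
def dynamics {d p : ℕ} (f₀ : E d → E d) (c : E p →L[ℝ] E d) (x : E d) (a : E p) : E d :=
  f₀ x + c a

/-- `∇ₓ ℓ(x, a)`. -/
noncomputable def gradX {d p : ℕ} (ℓ : E d → E p → ℝ) (x : E d) (a : E p) : E d :=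
  gradient (fun y => ℓ y a) x

/-- `∇ₐ ℓ(x, a)`. -/
noncomputable def gradA {d p : ℕ} (ℓ : E d → E p → ℝ) (x : E d) (a : E p) : E p :=
  gradient (fun b => ℓ x b) a

/-- Assumption on the initial cost: `u₀ ∈ C²`, `|∇u₀(x)| ≤ C₀ (1 + |x|)`, `|D²u₀(x)| ≤ C₀`. -/
structure InitialCostAssumption {d : ℕ} (u₀ : E d → ℝ) (C₀ : ℝ) : Prop where
  contDiff : ContDiff ℝ 2 u₀
  grad_le : ∀ x, ‖gradient u₀ x‖ ≤ C₀ * (1 + ‖x‖)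
  hess_le : ∀ x, ‖fderiv ℝ (fun y => gradient u₀ y) x‖ ≤ C₀

/-- Growth and convexity assumptions on the dynamics and the running cost. -/
structure GrowthAssumption {d p : ℕ} (f₀ : E d → E d) (c : E p →L[ℝ] E d) (ℓ : E d → E p → ℝ)
    (Cf Cl l₀ : ℝ) : Prop where
  contDiff_f : ContDiff ℝ 2 f₀
  norm_c_le : ‖c‖ ≤ Cf
  f_le : ∀ x a, ‖dynamics f₀ c x a‖ ≤ Cf * (1 + ‖x‖ + ‖a‖)
  Dxf_le : ∀ x a, ‖fderiv ℝ (fun y => dynamics f₀ c y a) x‖ ≤ Cf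
  contDiff_l : ContDiff ℝ 2 (fun z : E d × E p => ℓ z.1 z.2)
  /-- `D²ₐₐ ℓ(x, a) ≽ ℓ₀ 𝕀` -/
  convex_l : ∀ x a v, l₀ * ‖v‖ ^ 2 ≤ inner ℝ (fderiv ℝ (fun b => gradA ℓ x b) a v) v
  Dal_ge : ∀ x a, l₀ * (‖a‖ - 1) ≤ ‖gradA ℓ x a‖
  l_le : ∀ x a, |ℓ x a| ≤ Cl * (1 + ‖x‖ ^ 2 + ‖a‖ ^ 2)
  Dxl_le : ∀ x a, ‖gradX ℓ x a‖ ≤ Cl * (1 + ‖x‖ + ‖a‖)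

/-- Further assumptions on the second derivatives of the dynamics and on the running cost. -/
structure SecondOrderAssumption {d p : ℕ} (f₀ : E d → E d) (c : E p →L[ℝ] E d)
    (ℓ : E d → E p → ℝ) (Cf Cl : ℝ) : Prop where
  /-- `∑ᵢ |Dₓ(∂_{xᵢ} f(x, a))| ≤ C_f / (1 + |x|)` -/
  D2f_le : ∀ x a,
    ∑ i : Fin d, ‖fderiv ℝ (fun y => fderiv ℝ (fun z => dynamics f₀ c z a) y
      (EuclideanSpace.single i 1)) x‖ ≤ Cf / (1 + ‖x‖)
  l_lip : ∀ x₁ x₂ a₁ a₂, |ℓ x₁ a₁ - ℓ x₂ a₂| ≤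
    Cl * (1 + max ‖x₁‖ ‖x₂‖ + max ‖a₁‖ ‖a₂‖) * (‖x₁ - x₂‖ + ‖a₁ - a₂‖)
  Dxal_le : ∀ x a, ‖fderiv ℝ (fun b => gradX ℓ x b) a‖ ≤ Cl
  Daxl_le : ∀ x a, ‖fderiv ℝ (fun y => gradA ℓ y a) x‖ ≤ Cl
  Dxxl_le : ∀ x a, ‖fderiv ℝ (fun y => gradX ℓ y a) x‖ ≤ Cl

/-- `a = argmax_b (q · (-f(x, b)) - ℓ(x, b))`. -/
def IsArgmax {d p : ℕ} (f : E d → E p → E d) (ℓ : E d → E p → ℝ) (x q : E d) (a : E p) : Prop :=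
  IsMaxOn (fun b => inner ℝ q (-f x b) - ℓ x b) Set.univ a

/-- `μ` is a classical solution on `ℝᵈ × [0, T]` of the linear problem
`∂ₜ μ = Dμ · f(x, a) + Dₓf(x, a)ᵀ · ν + ∇ₓℓ(x, a)`, `μ(·, 0) = ∇u₀`,
for a given policy `a = a(x, t)` and a given field `ν = ν(x, t)`. Only joint differentiability
in the open strip and continuity up to its boundary are required, so every `C¹` solution counts. -/
structure IsTransportSolution {d p : ℕ} (T : ℝ) (u₀ : E d → ℝ) (f : E d → E p → E d)
    (ℓ : E d → E p → ℝ) (a : E d → ℝ → E p) (ν μ : E d → ℝ → E d) : Prop where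
  continuousOn : ContinuousOn (fun z : E d × ℝ => μ z.1 z.2) (Set.univ ×ˢ Set.Icc 0 T)
  differentiableAt : ∀ x, ∀ t ∈ Set.Ioo 0 T,
    DifferentiableAt ℝ (fun z : E d × ℝ => μ z.1 z.2) (x, t)
  pde : ∀ x, ∀ t ∈ Set.Ioo 0 T,
    deriv (fun s => μ x s) t =
      fderiv ℝ (fun y => μ y t) x (f x (a x t))
        + ContinuousLinearMap.adjoint (fderiv ℝ (fun y => f y (a x t)) x) (ν x t)
        + gradX ℓ x (a x t)
  initial : ∀ x, μ x 0 = gradient u₀ x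

/-- `(lam k, a k)`, `k = 0, 1, 2, …`, are the value-gradient policy iterates on `ℝᵈ × [0, T]`:
`lam 0 = ∇u₀`, `a k` is the greedy policy of `lam k`, and `lam (k + 1)` solves the linear transport
problem with policy `a k` and zeroth-order term evaluated at `lam k`. -/
structure IsIteration {d p : ℕ} (T : ℝ) (u₀ : E d → ℝ) (f : E d → E p → E d)
    (ℓ : E d → E p → ℝ) (lam : ℕ → E d → ℝ → E d) (a : ℕ → E d → ℝ → E p) : Prop where
  start : ∀ x, ∀ t ∈ Set.Icc 0 T, lam 0 x t = gradient u₀ x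
  policy : ∀ k x, ∀ t ∈ Set.Icc 0 T, IsArgmax f ℓ x (lam k x t) (a k x t)
  step : ∀ k, IsTransportSolution T u₀ f ℓ (a k) (lam k) (lam (k + 1))

/-- The weighted error, with values in `[0, ∞]`,
`e_k = ∫₀ᵀ e^{-γ t} ∫ |λ⁽ᵏ⁾ - λ⁽ᵏ⁻¹⁾|² / (1 + |x|²)^{2α} dx dt` (used for `k ≥ 1`). -/
noncomputable def err {d : ℕ} (T α γ : ℝ) (lam : ℕ → E d → ℝ → E d) (k : ℕ) : ℝ≥0∞ :=
  ∫⁻ t in Set.Icc 0 T, ENNReal.ofReal (Real.exp (-γ * t)) *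
    ∫⁻ x : E d, ENNReal.ofReal
      (‖lam k x t - lam (k - 1) x t‖ ^ 2 / (1 + ‖x‖ ^ 2) ^ (2 * α))

end PILambda

/-! The proof is by characteristics. Along a curve with `X' = -f(X, a⁽ᵏ⁾)`, the transport terms of
the equation for `λ⁽ᵏ⁺¹⁾` cancel and only the zeroth-order source remains. Everything is estimated
pointwise on such curves and integrated over space afterwards, so no integration by parts or decay
at infinity is needed, and all inequalities make sense in `[0, ∞]`.

Uniform regularity: strong convexity of the cost in the action makes the greedy action Lipschitz in
state and costate (`IsArgmax.norm_sub_le`). For small `T` the flow distorts `1 + |x|` and distances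
by at most a factor 2, and the source contributes at most 1. Hence growth and Lipschitz bounds with
`M = 2 C₀ + 1` reproduce themselves at every step (`IsTransportSolution.isRegular`). The decay of
`D²f` is what compensates the linear growth of the costate here.

Contraction: along the newer characteristics, the difference of two consecutive iterates has
derivative at most `κ` times the previous difference, and it vanishes at time 0
(`IsTransportSolution.norm_sub_sq_le`). Cauchy–Schwarz, the factor-64 comparability of the weights
and the volume factor `2 ^ d` of the inverse flow give slice bounds
(`lintegral_weight_le_of_characteristic`). Integration in time yields the factor `64 κ² 2ᵈ T²`,
which is at most `1/2` for small `T`. -/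

namespace PILambda

open Set MeasureTheory

/-! ### Tools: short-time Gronwall, characteristics, change of variables, Cauchy–Schwarz. -/

/-- A Gronwall-type bound, symmetric in the two times, on a short time interval. -/
theorem add_norm_le_two_mul_of_norm_deriv_le {F : Type*} [NormedAddCommGroup F] [NormedSpace ℝ F]
    {T κ b : ℝ} {h h' : ℝ → F}
    (hd : ∀ s ∈ Icc 0 T, HasDerivWithinAt h (h' s) (Icc 0 T) s)
    (hb : ∀ s ∈ Icc 0 T, ‖h' s‖ ≤ κ * (b + ‖h s‖)) (hκ : 0 ≤ κ) (hκT : κ * T ≤ 1 / 2)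
    (hb0 : 0 ≤ b) {s t : ℝ} (hs : s ∈ Icc 0 T) (ht : t ∈ Icc 0 T) :
    b + ‖h s‖ ≤ 2 * (b + ‖h t‖) := by
  have hc : ContinuousOn (fun s => ‖h s‖) (Icc 0 T) :=
    ContinuousOn.norm fun s hs => (hd s hs).continuousWithinAt
  -- At a maximum point `m` of the norm, the mean value inequality between `t` and `m` costs at most
  -- half of `b + ‖h m‖`, which is absorbed on the left. Nothing depends on the order of `s` and
  -- `t`.
  obtain ⟨m, hm, hmax⟩ := isCompact_Icc.exists_isMaxOn ⟨t, ht⟩ hc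
  have hle : ∀ r ∈ Icc 0 T, ‖h r‖ ≤ ‖h m‖ := fun r hr => hmax hr
  have hS : 0 ≤ b + ‖h m‖ := by positivity
  have key := (convex_Icc (0 : ℝ) T).norm_image_sub_le_of_norm_hasDerivWithin_le
    (C := κ * (b + ‖h m‖)) hd
    (fun r hr => (hb r hr).trans (by gcongr; exact hle r hr)) ht hm
  have h1 : ‖m - t‖ ≤ T := by
    rw [Real.norm_eq_abs, abs_le]; constructor <;> linarith [hm.1, hm.2, ht.1, ht.2]
  have h2 : κ * (b + ‖h m‖) * ‖m - t‖ ≤ 1 / 2 * (b + ‖h m‖) := by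
    calc κ * (b + ‖h m‖) * ‖m - t‖ ≤ κ * (b + ‖h m‖) * T := by gcongr
      _ = κ * T * (b + ‖h m‖) := by ring
      _ ≤ _ := by gcongr
  have h3 := norm_sub_norm_le (h m) (h t)
  have := hle s hs
  linarith

/-- Global existence of characteristics of a Lipschitz field with linear growth, on a short time
interval. -/
theorem exists_characteristic {F : Type*} [NormedAddCommGroup F] [NormedSpace ℝ F]
    [CompleteSpace F] {T Λ N : ℝ} {V : F → ℝ → F} (hΛ : 0 ≤ Λ) (hN : 0 ≤ N)
    (hcont : ∀ x, ContinuousOn (V x) (Icc 0 T))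
    (hlip : ∀ t ∈ Icc 0 T, ∀ x y, ‖V x t - V y t‖ ≤ Λ * ‖x - y‖)
    (hgrow : ∀ t ∈ Icc 0 T, ∀ x, ‖V x t‖ ≤ N * (1 + ‖x‖)) (hNT : N * T ≤ 1 / 2)
    {t : ℝ} (ht : t ∈ Icc 0 T) (y : F) :
    ∃ X : ℝ → F, X t = y ∧ ∀ s ∈ Icc 0 T, HasDerivWithinAt X (-V (X s) s) (Icc 0 T) s := by
  have hT : 0 ≤ T := ht.1.trans ht.2
  -- A ball of radius `1 + ‖y‖` scales with the linear growth of `V`: on it the speed is at most `2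
  -- N (1 + ‖y‖)`, so `N T ≤ 1/2` suffices for every `y` and a single Picard–Lindelöf step covers
  -- `[0, T]`.
  let a : ℝ≥0 := ⟨1 + ‖y‖, by positivity⟩
  let L : ℝ≥0 := ⟨N * (2 * (1 + ‖y‖)), by positivity⟩
  have hpl : IsPicardLindelof (fun s x => -V x s) (⟨t, ht⟩ : Icc 0 T) y a 0 L ⟨Λ, hΛ⟩ := by
    refine ⟨fun s hs => ?_, fun x _ => (hcont x).neg, fun s hs x hx => ?_, ?_⟩
    · refine LipschitzOnWith.of_dist_le_mul fun x _ z _ => ?_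
      rw [dist_neg_neg, dist_eq_norm, dist_eq_norm]
      exact hlip s hs x z
    · rw [norm_neg]
      refine (hgrow s hs x).trans ?_
      change _ ≤ N * (2 * (1 + ‖y‖))
      have : ‖x - y‖ ≤ 1 + ‖y‖ := (dist_eq_norm x y).symm.trans_le hx
      have h2 := norm_sub_norm_le x y
      gcongr
      linarith
    · have : max (T - t) (t - 0) ≤ T := max_le (by linarith [ht.1]) (by linarith [ht.2])
      change N * (2 * (1 + ‖y‖)) * max (T - t) (t - 0) ≤ (1 + ‖y‖) - 0
      calc N * (2 * (1 + ‖y‖)) * max (T - t) (t - 0) ≤ N * (2 * (1 + ‖y‖)) * T := by gcongr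
        _ = 2 * (N * T) * (1 + ‖y‖) := by ring
        _ ≤ 2 * (1 / 2) * (1 + ‖y‖) := by gcongr
        _ = _ := by ring
  obtain ⟨X, hX, hXd⟩ := hpl.exists_eq_forall_mem_Icc_hasDerivWithinAt (x := y) (by simp)
  exact ⟨X, hX, hXd⟩

/-- Composition with an expanding-up-to-a-factor map increases integrals at most by the
corresponding Jacobian factor. -/
theorem lintegral_comp_le_of_antilipschitzWith {d : ℕ} {K : ℝ≥0} {g : E d → E d}
    (hg : AntilipschitzWith K g) (hgm : Measurable g) {φ : E d → ℝ≥0∞} (hφ : Measurable φ) :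
    ∫⁻ x, φ (g x) ≤ (K : ℝ≥0∞) ^ d * ∫⁻ x, φ x := by
  -- Hausdorff measure controls preimages under antilipschitz maps directly, and Lebesgue measure is
  -- a multiple of it. No differentiability of `g` and no Jacobian is involved.
  have hH : (Measure.hausdorffMeasure (d : ℝ) : Measure (E d)).IsAddHaarMeasure := by
    simpa using isAddHaarMeasure_hausdorffMeasure (E := E d)
  have hvol := Measure.isAddLeftInvariant_eq_smul (volume : Measure (E d))
    (Measure.hausdorffMeasure (d : ℝ))
  have hmap : Measure.map g volume ≤ ((K : ℝ≥0∞) ^ d) • (volume : Measure (E d)) := by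
    refine Measure.le_iff.2 fun s hs => ?_
    rw [Measure.map_apply hgm hs, hvol]
    simp only [Measure.smul_apply, smul_eq_mul, ENNReal.smul_def]
    have := hg.hausdorffMeasure_preimage_le (d := d) (by positivity) s
    rw [ENNReal.rpow_natCast] at this
    rw [mul_left_comm]
    gcongr
  rw [← lintegral_map hφ hgm, ← smul_eq_mul, ← lintegral_smul_measure]
  exact lintegral_mono' hmap le_rfl

/-- The Cauchy–Schwarz inequality against a constant. -/
theorem sq_intervalIntegral_le {t : ℝ} (ht : 0 ≤ t) {h : ℝ → ℝ} (hc : ContinuousOn h (Icc 0 t)) :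
    (∫ s in (0 : ℝ)..t, h s) ^ 2 ≤ t * ∫ s in (0 : ℝ)..t, h s ^ 2 := by
  rcases ht.eq_or_lt with rfl | htpos
  · simp
  have hi : IntervalIntegrable h volume 0 t :=
    ContinuousOn.intervalIntegrable (by rwa [uIcc_of_le ht])
  have hi2 : IntervalIntegrable (fun s => h s ^ 2) volume 0 t :=
    ContinuousOn.intervalIntegrable (by rw [uIcc_of_le ht]; exact hc.pow 2)
  set I := ∫ s in (0 : ℝ)..t, h s with hI
  -- This is the variance of `h`, cleared of denominators.
  have hnn : 0 ≤ ∫ s in (0 : ℝ)..t, (t * h s - I) ^ 2 :=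
    intervalIntegral.integral_nonneg ht fun s _ => sq_nonneg _
  have heq : ∫ s in (0 : ℝ)..t, (t * h s - I) ^ 2
      = t * (t * (∫ s in (0 : ℝ)..t, h s ^ 2) - I ^ 2) := by
    have : ∀ s, (t * h s - I) ^ 2 = t ^ 2 * h s ^ 2 - 2 * t * I * h s + I ^ 2 := fun s => by ring
    simp_rw [this]
    rw [intervalIntegral.integral_add ((hi2.const_mul _).sub (hi.const_mul _)) (by simp),
      intervalIntegral.integral_sub (hi2.const_mul _) (hi.const_mul _),
      intervalIntegral.integral_const_mul, intervalIntegral.integral_const_mul, ← hI]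
    simp
    ring
  rw [heq] at hnn
  have := (mul_nonneg_iff_of_pos_left htpos).1 hnn
  linarith

/-! ### Running cost and regularity of the greedy action. -/

section Cost

variable {d p : ℕ} {f₀ : E d → E d} {c : E p →L[ℝ] E d} {ℓ : E d → E p → ℝ} {Cf Cl l₀ : ℝ}

theorem hasGradientAt_gradA (hℓ : ContDiff ℝ 2 (fun z : E d × E p => ℓ z.1 z.2)) (x : E d)
    (a : E p) : HasGradientAt (fun b => ℓ x b) (gradA ℓ x a) a := by
  have h : ContDiff ℝ 2 (fun b => ℓ x b) := hℓ.comp (contDiff_const.prodMk contDiff_id)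
  exact ((h.differentiable (by norm_num)) a).hasGradientAt

theorem differentiable_gradX (hℓ : ContDiff ℝ 2 (fun z : E d × E p => ℓ z.1 z.2)) :
    Differentiable ℝ (fun z : E d × E p => gradX ℓ z.1 z.2) := by
  have h1 : ContDiff ℝ 1 (fun z : E d × E p => fderiv ℝ (fun y => ℓ y z.2) z.1) :=
    ContDiff.fderiv (f := fun (z : E d × E p) (y : E d) => ℓ y z.2) (m := 2) (n := 1)
      (hℓ.comp (contDiff_snd.prodMk (contDiff_snd.comp contDiff_fst))) contDiff_fst (by norm_num)
  exact (InnerProductSpace.toDual ℝ (E d)).symm.toContinuousLinearEquiv.differentiable.comp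
    (h1.differentiable (by norm_num))

theorem differentiable_gradA (hℓ : ContDiff ℝ 2 (fun z : E d × E p => ℓ z.1 z.2)) :
    Differentiable ℝ (fun z : E d × E p => gradA ℓ z.1 z.2) := by
  have h1 : ContDiff ℝ 1 (fun z : E d × E p => fderiv ℝ (fun b => ℓ z.1 b) z.2) :=
    ContDiff.fderiv (f := fun (z : E d × E p) (b : E p) => ℓ z.1 b) (m := 2) (n := 1)
      (hℓ.comp ((contDiff_fst.comp contDiff_fst).prodMk contDiff_snd)) contDiff_snd (by norm_num)
  exact (InnerProductSpace.toDual ℝ (E p)).symm.toContinuousLinearEquiv.differentiable.comp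
    (h1.differentiable (by norm_num))

theorem norm_gradX_sub_le (hG : GrowthAssumption f₀ c ℓ Cf Cl l₀)
    (hS : SecondOrderAssumption f₀ c ℓ Cf Cl) (x y : E d) (a b : E p) :
    ‖gradX ℓ x a - gradX ℓ y b‖ ≤ Cl * ‖x - y‖ + Cl * ‖a - b‖ := by
  have hd := differentiable_gradX hG.contDiff_l
  have h1 : ‖gradX ℓ x a - gradX ℓ y a‖ ≤ Cl * ‖x - y‖ :=
    convex_univ.norm_image_sub_le_of_norm_fderiv_le (𝕜 := ℝ) (f := fun z => gradX ℓ z a)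
      (fun z _ => (hd.comp (differentiable_id.prodMk (differentiable_const a))) z)
      (fun z _ => hS.Dxxl_le z a) (mem_univ y) (mem_univ x)
  have h2 : ‖gradX ℓ y a - gradX ℓ y b‖ ≤ Cl * ‖a - b‖ :=
    convex_univ.norm_image_sub_le_of_norm_fderiv_le (𝕜 := ℝ) (f := fun z => gradX ℓ y z)
      (fun z _ => (hd.comp ((differentiable_const y).prodMk differentiable_id)) z)
      (fun z _ => hS.Dxal_le y z) (mem_univ b) (mem_univ a)
  have := norm_sub_le_norm_sub_add_norm_sub (gradX ℓ x a) (gradX ℓ y a) (gradX ℓ y b)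
  linarith

theorem norm_gradA_sub_le (hG : GrowthAssumption f₀ c ℓ Cf Cl l₀)
    (hS : SecondOrderAssumption f₀ c ℓ Cf Cl) (x y : E d) (a : E p) :
    ‖gradA ℓ x a - gradA ℓ y a‖ ≤ Cl * ‖x - y‖ :=
  convex_univ.norm_image_sub_le_of_norm_fderiv_le (𝕜 := ℝ) (f := fun z => gradA ℓ z a)
    (fun z _ => ((differentiable_gradA hG.contDiff_l).comp
      (differentiable_id.prodMk (differentiable_const a))) z)
    (fun z _ => hS.Daxl_le z a) (mem_univ y) (mem_univ x)

/-- The action gradient of the running cost is strongly monotone. -/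
theorem mul_norm_sub_sq_le_inner_gradA_sub (hG : GrowthAssumption f₀ c ℓ Cf Cl l₀) (x : E d)
    (a b : E p) : l₀ * ‖a - b‖ ^ 2 ≤ inner ℝ (gradA ℓ x a - gradA ℓ x b) (a - b) := by
  have hline : ∀ s : ℝ, HasDerivAt (fun s : ℝ => b + s • (a - b)) (a - b) s := fun s => by
    simpa using ((hasDerivAt_id s).smul_const (a - b)).const_add b
  have hd : ∀ z, DifferentiableAt ℝ (fun w => gradA ℓ x w) z := 
    (differentiable_gradA hG.contDiff_l).comp
      ((differentiable_const x).prodMk differentiable_id)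
  have hder : ∀ s : ℝ, HasDerivAt (fun s : ℝ => inner ℝ (gradA ℓ x (b + s • (a - b))) (a - b))
      (inner ℝ (fderiv ℝ (fun w => gradA ℓ x w) (b + s • (a - b)) (a - b)) (a - b)) s :=
    fun s => by
      have := (((hd (b + s • (a - b))).hasFDerivAt).comp_hasDerivAt s (hline s)).inner ℝ
        (hasDerivAt_const s (a - b))
      simpa using this
  have := Convex.mul_sub_le_image_sub_of_le_deriv (convex_univ)
    (fun s _ => (hder s).continuousAt.continuousWithinAt)
    (fun s _ => (hder s).differentiableAt.differentiableWithinAt)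
    (C := l₀ * ‖a - b‖ ^ 2)
    (fun s _ => by rw [(hder s).deriv]; exact hG.convex_l x _ _)
    0 (mem_univ _) 1 (mem_univ _) zero_le_one
  simpa [inner_sub_left] using this

/-- First-order optimality. Since the control enters the dynamics affinely, the right-hand side is
linear in `q` and independent of both `x` and `a`. -/
theorem IsArgmax.gradA_eq (hℓ : ContDiff ℝ 2 (fun z : E d × E p => ℓ z.1 z.2)) {x q : E d}
    {a : E p} (h : IsArgmax (dynamics f₀ c) ℓ x q a) :
    gradA ℓ x a = -ContinuousLinearMap.adjoint c q := by
  have hloc : IsLocalMax (fun b => inner ℝ q (-dynamics f₀ c x b) - ℓ x b) a :=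
    h.isLocalMax Filter.univ_mem
  have hl := (hasGradientAt_gradA hℓ x a).hasFDerivAt
  have hf : HasFDerivAt (fun b => -dynamics f₀ c x b) (-c) a :=
    (c.hasFDerivAt.const_add (f₀ x)).neg
  have hz := hloc.hasFDerivAt_eq_zero ((((innerSL ℝ q).hasFDerivAt).comp a hf).sub hl)
  refine ext_inner_right ℝ fun v => ?_
  have := DFunLike.congr_fun hz v
  simp only [_root_.sub_apply, ContinuousLinearMap.comp_apply,
    _root_.neg_apply, innerSL_apply_apply, InnerProductSpace.toDual_apply_apply,
    inner_neg_right, _root_.zero_apply] at this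
  rw [inner_neg_left, ContinuousLinearMap.adjoint_inner_left]
  linarith

theorem norm_adjoint_apply_le {F G : Type*} [NormedAddCommGroup F] [InnerProductSpace ℝ F]
    [CompleteSpace F] [NormedAddCommGroup G] [InnerProductSpace ℝ G] [CompleteSpace G]
    {A : F →L[ℝ] G} {C : ℝ} (hA : ‖A‖ ≤ C) (q : G) :
    ‖ContinuousLinearMap.adjoint A q‖ ≤ C * ‖q‖ :=
  ContinuousLinearMap.le_of_opNorm_le _ (by rwa [LinearIsometryEquiv.norm_map]) q

/-- Lipschitz dependence of the greedy action on the state and the costate. -/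
theorem IsArgmax.norm_sub_le (hG : GrowthAssumption f₀ c ℓ Cf Cl l₀)
    (hS : SecondOrderAssumption f₀ c ℓ Cf Cl) (hl₀ : 0 < l₀) {x y q r : E d} {a b : E p}
    (ha : IsArgmax (dynamics f₀ c) ℓ x q a) (hb : IsArgmax (dynamics f₀ c) ℓ y r b) :
    ‖a - b‖ ≤ Cl / l₀ * ‖x - y‖ + Cf / l₀ * ‖q - r‖ := by
  have h1 := mul_norm_sub_sq_le_inner_gradA_sub hG x a b
  have h2 := norm_gradA_sub_le hG hS x y b
  have h3 := norm_adjoint_apply_le hG.norm_c_le (q - r)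
  -- Monotonicity applies only at a common state, so the optimality condition of `b` is transported
  -- from `y` to `x`, at the price of the mixed derivative.
  have h4 : gradA ℓ x a - gradA ℓ x b
      = -ContinuousLinearMap.adjoint c (q - r) - (gradA ℓ x b - gradA ℓ y b) := by
    rw [ha.gradA_eq hG.contDiff_l, hb.gradA_eq hG.contDiff_l, map_sub]
    abel
  have h5 : ‖gradA ℓ x a - gradA ℓ x b‖ ≤ Cf * ‖q - r‖ + Cl * ‖x - y‖ := by
    rw [h4]
    refine (_root_.norm_sub_le _ _).trans ?_
    rw [norm_neg]
    exact add_le_add h3 h2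
  have h6 : l₀ * ‖a - b‖ ≤ Cf * ‖q - r‖ + Cl * ‖x - y‖ := by
    rcases (norm_nonneg (a - b)).eq_or_lt with h0 | h0
    · rw [← h0, mul_zero]; exact (norm_nonneg _).trans h5
    · refine le_of_mul_le_mul_right ?_ h0
      calc l₀ * ‖a - b‖ * ‖a - b‖ = l₀ * ‖a - b‖ ^ 2 := by ring
        _ ≤ ‖gradA ℓ x a - gradA ℓ x b‖ * ‖a - b‖ := h1.trans (real_inner_le_norm _ _)
        _ ≤ _ := by gcongr
  have h7 : Cl / l₀ * ‖x - y‖ + Cf / l₀ * ‖q - r‖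
      = (Cf * ‖q - r‖ + Cl * ‖x - y‖) / l₀ := by ring
  rw [h7, le_div_iff₀ hl₀]
  linarith

/-- The coercivity of the action gradient turns the first-order condition into an a priori bound. -/
theorem IsArgmax.norm_le (hG : GrowthAssumption f₀ c ℓ Cf Cl l₀) (hl₀ : 0 < l₀) {x q : E d}
    {a : E p} (ha : IsArgmax (dynamics f₀ c) ℓ x q a) : ‖a‖ ≤ 1 + Cf / l₀ * ‖q‖ := by
  have h1 := hG.Dal_ge x a
  rw [ha.gradA_eq hG.contDiff_l, norm_neg] at h1
  have h2 := h1.trans (norm_adjoint_apply_le hG.norm_c_le q)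
  have h3 : Cf / l₀ * ‖q‖ = Cf * ‖q‖ / l₀ := by ring
  rw [← sub_le_iff_le_add', h3, le_div_iff₀ hl₀]
  linarith

end Cost

/-! ### Derivatives of the drift. -/

section Dynamics

variable {d p : ℕ} {f₀ : E d → E d} {c : E p →L[ℝ] E d} {ℓ : E d → E p → ℝ} {Cf Cl l₀ : ℝ}

theorem fderiv_dynamics (x : E d) (a : E p) :
    fderiv ℝ (fun y => dynamics f₀ c y a) x = fderiv ℝ f₀ x :=
  fderiv_add_const (f := f₀) (c a)

theorem GrowthAssumption.norm_fderiv_le (hG : GrowthAssumption f₀ c ℓ Cf Cl l₀) (x : E d) :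
    ‖fderiv ℝ f₀ x‖ ≤ Cf := by
  have := hG.Dxf_le x 0
  rwa [fderiv_dynamics] at this

theorem GrowthAssumption.norm_sub_le (hG : GrowthAssumption f₀ c ℓ Cf Cl l₀) (x y : E d) :
    ‖f₀ x - f₀ y‖ ≤ Cf * ‖x - y‖ :=
  convex_univ.norm_image_sub_le_of_norm_fderiv_le (𝕜 := ℝ)
    (fun z _ => hG.contDiff_f.differentiable (by norm_num) z)
    (fun z _ => hG.norm_fderiv_le z) (mem_univ y) (mem_univ x)

/-- The hypothesis bounds the derivatives of the partial derivatives of the drift. Symmetry of the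
second derivative is not needed: only the inner argument `v` is expanded in the standard basis, with
coordinates at most `‖v‖`. -/
theorem norm_fderiv_fderiv_le (hG : GrowthAssumption f₀ c ℓ Cf Cl l₀)
    (hS : SecondOrderAssumption f₀ c ℓ Cf Cl) (x : E d) :
    ‖fderiv ℝ (fderiv ℝ f₀) x‖ ≤ Cf / (1 + ‖x‖) := by
  have hCf : 0 ≤ Cf := (norm_nonneg _).trans hG.norm_c_le
  have hd : DifferentiableAt ℝ (fderiv ℝ f₀) x :=
    (hG.contDiff_f.fderiv_right (m := 1) (by norm_num)).differentiable (by norm_num) x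
  have hS' := hS.D2f_le x 0
  simp only [fderiv_dynamics] at hS'
  have hi : ∀ v u : E d, fderiv ℝ (fun y => fderiv ℝ f₀ y v) x u
      = fderiv ℝ (fderiv ℝ f₀) x u v := fun v u => by
    rw [(hd.hasFDerivAt.clm_apply (hasFDerivAt_const v x)).fderiv]
    simp
  refine ContinuousLinearMap.opNorm_le_bound _ (by positivity) fun u => ?_
  refine ContinuousLinearMap.opNorm_le_bound _ (by positivity) fun v => ?_
  have hv : v = ∑ i, v i • EuclideanSpace.single i (1 : ℝ) := by
    have := (EuclideanSpace.basisFun (Fin d) ℝ).sum_repr v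
    simpa using this.symm
  calc ‖fderiv ℝ (fderiv ℝ f₀) x u v‖
      = ‖∑ i, v i • fderiv ℝ (fderiv ℝ f₀) x u (EuclideanSpace.single i (1 : ℝ))‖ := by
        conv_lhs => rw [hv]
        simp only [map_sum, map_smul]
    _ ≤ ∑ i, ‖v‖ * (‖fderiv ℝ (fun y => fderiv ℝ f₀ y (EuclideanSpace.single i (1 : ℝ))) x‖
          * ‖u‖) := by
        refine norm_sum_le_of_le _ fun i _ => ?_
        rw [norm_smul, ← hi]
        gcongr
        · exact PiLp.norm_apply_le v i
        · exact ContinuousLinearMap.le_opNorm _ _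
    _ = (∑ i, ‖fderiv ℝ (fun y => fderiv ℝ f₀ y (EuclideanSpace.single i (1 : ℝ))) x‖)
          * ‖u‖ * ‖v‖ := by
        rw [← Finset.mul_sum, ← Finset.sum_mul]; ring
    _ ≤ _ := by gcongr

/-- The derivative of the drift is Lipschitz with a constant decaying like `1 / |x|`. -/
theorem one_add_norm_mul_norm_fderiv_sub_le (hG : GrowthAssumption f₀ c ℓ Cf Cl l₀)
    (hS : SecondOrderAssumption f₀ c ℓ Cf Cl) (x y : E d) :
    (1 + ‖x‖) * ‖fderiv ℝ f₀ x - fderiv ℝ f₀ y‖ ≤ 8 * Cf * ‖x - y‖ := by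
  have hCf : 0 ≤ Cf := (norm_nonneg _).trans hG.norm_c_le
  have hd : ∀ z, DifferentiableAt ℝ (fderiv ℝ f₀) z :=
    (hG.contDiff_f.fderiv_right (m := 1) (by norm_num)).differentiable (by norm_num)
  -- If `y` is far from `x` relative to `1 + ‖x‖`, the uniform bound on the first derivative is
  -- enough. Otherwise `1 + ‖z‖` stays above half of `1 + ‖x‖` on the whole ball around `x` through
  -- `y`, so the decaying second-derivative bound is usable there.
  rcases le_total (1 + ‖x‖) (4 * ‖x - y‖) with h | h
  · have : ‖fderiv ℝ f₀ x - fderiv ℝ f₀ y‖ ≤ Cf + Cf :=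
      (_root_.norm_sub_le _ _).trans (add_le_add (hG.norm_fderiv_le x) (hG.norm_fderiv_le y))
    calc (1 + ‖x‖) * ‖fderiv ℝ f₀ x - fderiv ℝ f₀ y‖ ≤ 4 * ‖x - y‖ * (Cf + Cf) := by gcongr
      _ = _ := by ring
  · have hball : ∀ z ∈ Metric.closedBall x ‖x - y‖,
        ‖fderiv ℝ (fderiv ℝ f₀) z‖ ≤ 2 * Cf / (1 + ‖x‖) := fun z hz => by
      refine (norm_fderiv_fderiv_le hG hS z).trans ?_
      rw [Metric.mem_closedBall, dist_comm, dist_eq_norm] at hz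
      have h1 := norm_sub_norm_le x z
      rw [div_le_div_iff₀ (by positivity) (by positivity)]
      have : 1 + ‖x‖ ≤ 2 * (1 + ‖z‖) := by linarith [norm_nonneg x]
      calc Cf * (1 + ‖x‖) ≤ Cf * (2 * (1 + ‖z‖)) := by gcongr
        _ = _ := by ring
    have := (convex_closedBall x ‖x - y‖).norm_image_sub_le_of_norm_fderiv_le (𝕜 := ℝ)
      (fun z _ => hd z) hball (x := y) (y := x)
      (by rw [Metric.mem_closedBall, dist_comm, dist_eq_norm])
      (Metric.mem_closedBall_self (norm_nonneg _))
    calc (1 + ‖x‖) * ‖fderiv ℝ f₀ x - fderiv ℝ f₀ y‖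
        ≤ (1 + ‖x‖) * (2 * Cf / (1 + ‖x‖) * ‖x - y‖) := by gcongr
      _ = 2 * Cf * ‖x - y‖ := by field_simp
      _ ≤ _ := by gcongr; norm_num

/-- The growth of `q` is paired with the variation of the Jacobian, whose decay like `1 / (1 + ‖x‖)`
cancels it. Without this cancellation the Lipschitz bound on the costates would not propagate. -/
theorem norm_adjoint_fderiv_sub_le (hG : GrowthAssumption f₀ c ℓ Cf Cl l₀)
    (hS : SecondOrderAssumption f₀ c ℓ Cf Cl) {M : ℝ} {x y q r : E d} (hM : 0 ≤ M)
    (hq : ‖q‖ ≤ M * (1 + ‖x‖)) :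
    ‖ContinuousLinearMap.adjoint (fderiv ℝ f₀ x) q
        - ContinuousLinearMap.adjoint (fderiv ℝ f₀ y) r‖
      ≤ 8 * Cf * M * ‖x - y‖ + Cf * ‖q - r‖ := by
  have h1 := norm_adjoint_apply_le (hG.norm_fderiv_le y) (q - r)
  have h2 := norm_adjoint_apply_le (le_refl ‖fderiv ℝ f₀ x - fderiv ℝ f₀ y‖) q
  have h3 := one_add_norm_mul_norm_fderiv_sub_le hG hS x y
  have h4 : ContinuousLinearMap.adjoint (fderiv ℝ f₀ x) q
      - ContinuousLinearMap.adjoint (fderiv ℝ f₀ y) r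
      = ContinuousLinearMap.adjoint (fderiv ℝ f₀ x - fderiv ℝ f₀ y) q
        + ContinuousLinearMap.adjoint (fderiv ℝ f₀ y) (q - r) := by
    simp [map_sub]
  rw [h4]
  refine (norm_add_le _ _).trans (add_le_add (h2.trans ?_) h1)
  calc ‖fderiv ℝ f₀ x - fderiv ℝ f₀ y‖ * ‖q‖
      ≤ ‖fderiv ℝ f₀ x - fderiv ℝ f₀ y‖ * (M * (1 + ‖x‖)) := by gcongr
    _ = M * ((1 + ‖x‖) * ‖fderiv ℝ f₀ x - fderiv ℝ f₀ y‖) := by ring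
    _ ≤ M * (8 * Cf * ‖x - y‖) := by gcongr
    _ = _ := by ring

end Dynamics

/-! ### Regular fields and their characteristics. -/

/-- Time-continuous fields on `ℝᵈ × [0, T]` which are Lipschitz with linear growth in space,
uniformly in time. -/
structure IsRegular {d : ℕ} {F : Type*} [NormedAddCommGroup F] (T K : ℝ) (φ : E d → ℝ → F) :
    Prop where
  continuousOn : ∀ x, ContinuousOn (φ x) (Icc 0 T)
  norm_le : ∀ t ∈ Icc 0 T, ∀ x, ‖φ x t‖ ≤ K * (1 + ‖x‖)
  norm_sub_le : ∀ t ∈ Icc 0 T, ∀ x y, ‖φ x t - φ y t‖ ≤ K * ‖x - y‖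

namespace IsRegular

variable {d : ℕ} {F : Type*} [NormedAddCommGroup F] {T K : ℝ} {φ ψ : E d → ℝ → F}

theorem continuousOn_prod (h : IsRegular T K φ) :
    ContinuousOn (fun z : E d × ℝ => φ z.1 z.2) (univ ×ˢ Icc 0 T) :=
  continuousOn_prod_of_continuousOn_lipschitzOnWith (fun z : E d × ℝ => φ z.1 z.2) K.toNNReal
    (fun x _ => h.continuousOn x) fun t ht => LipschitzOnWith.of_dist_le' fun x _ y _ => by
      rw [dist_eq_norm, dist_eq_norm]; exact h.norm_sub_le t ht x y

theorem sub (h : IsRegular T K φ) (h' : IsRegular T K ψ) :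
    IsRegular T (2 * K) fun x t => φ x t - ψ x t where
  continuousOn x := (h.continuousOn x).sub (h'.continuousOn x)
  norm_le t ht x := by
    have := _root_.norm_sub_le (φ x t) (ψ x t)
    have := h.norm_le t ht x
    have := h'.norm_le t ht x
    linarith
  norm_sub_le t ht x y := by
    have := _root_.norm_sub_le (φ x t - φ y t) (ψ x t - ψ y t)
    have := h.norm_sub_le t ht x y
    have := h'.norm_sub_le t ht x y
    rw [sub_sub_sub_comm]
    linarith

end IsRegular

/-- `X` is a characteristic of the transport operator `∂ₜ - V · ∇` on the time interval `[0, T]`. -/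
def IsCharacteristic {d : ℕ} (T : ℝ) (V : E d → ℝ → E d) (X : ℝ → E d) : Prop :=
  ∀ s ∈ Icc 0 T, HasDerivWithinAt X (-V (X s) s) (Icc 0 T) s

theorem IsRegular.exists_isCharacteristic {d : ℕ} {T N : ℝ} {V : E d → ℝ → E d}
    (hV : IsRegular T N V) (hN : 0 ≤ N) (hNT : N * T ≤ 1 / 2) {t : ℝ} (ht : t ∈ Icc 0 T)
    (y : E d) : ∃ X : ℝ → E d, X t = y ∧ IsCharacteristic T V X :=
  exists_characteristic hN hN hV.continuousOn hV.norm_sub_le hV.norm_le hNT ht y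

namespace IsCharacteristic

variable {d : ℕ} {T N : ℝ} {V : E d → ℝ → E d} {X Y : ℝ → E d}

theorem continuousOn (hX : IsCharacteristic T V X) : ContinuousOn X (Icc 0 T) :=
  fun s hs => (hX s hs).continuousWithinAt

theorem continuousOn_comp {K : ℝ} {F : Type*} [NormedAddCommGroup F] {φ : E d → ℝ → F}
    (hX : IsCharacteristic T V X) (hφ : IsRegular T K φ) :
    ContinuousOn (fun s => φ (X s) s) (Icc 0 T) :=
  hφ.continuousOn_prod.comp (hX.continuousOn.prodMk continuousOn_id) fun _ hs => ⟨mem_univ _, hs⟩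

theorem one_add_norm_le (hX : IsCharacteristic T V X) (hV : IsRegular T N V) (hN : 0 ≤ N)
    (hNT : N * T ≤ 1 / 2) {s t : ℝ} (hs : s ∈ Icc 0 T) (ht : t ∈ Icc 0 T) :
    1 + ‖X s‖ ≤ 2 * (1 + ‖X t‖) :=
  add_norm_le_two_mul_of_norm_deriv_le hX
    (fun r hr => by rw [norm_neg]; exact hV.norm_le r hr _) hN hNT zero_le_one hs ht

/-- Gronwall with `b = 0`. Because `s` and `t` are interchangeable, this gives both the Lipschitz
and the antilipschitz bound for the flow between two times. -/
theorem norm_sub_le (hX : IsCharacteristic T V X) (hY : IsCharacteristic T V Y)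
    (hV : IsRegular T N V) (hN : 0 ≤ N) (hNT : N * T ≤ 1 / 2) {s t : ℝ} (hs : s ∈ Icc 0 T)
    (ht : t ∈ Icc 0 T) : ‖X s - Y s‖ ≤ 2 * ‖X t - Y t‖ := by
  have := add_norm_le_two_mul_of_norm_deriv_le (h := fun s => X s - Y s) (b := 0)
    (fun r hr => (hX r hr).sub (hY r hr))
    (fun r hr => by
      rw [zero_add, neg_sub_neg, norm_sub_rev (X r)]
      exact hV.norm_sub_le r hr _ _) hN hNT le_rfl hs ht
  simpa using this

/-- The chain rule, with `μ` unrelated to `V`: it also serves for an iterate followed along the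
characteristics of another policy. -/
theorem hasDerivAt_comp {G : Type*} [NormedAddCommGroup G] [NormedSpace ℝ G] {μ : E d → ℝ → G}
    (hX : IsCharacteristic T V X) {s : ℝ} (hs : s ∈ Ioo 0 T)
    (hμ : DifferentiableAt ℝ (fun z : E d × ℝ => μ z.1 z.2) (X s, s)) :
    HasDerivAt (fun r => μ (X r) r)
      (deriv (fun r => μ (X s) r) s - fderiv ℝ (fun y => μ y s) (X s) (V (X s) s)) s := by
  have hXs : HasDerivAt X (-V (X s) s) s :=
    (hX s (Ioo_subset_Icc_self hs)).hasDerivAt (Icc_mem_nhds hs.1 hs.2)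
  have h1 : HasDerivAt (fun r => μ (X r) r) _ s :=
    HasFDerivAt.comp_hasDerivAt s (l := fun z : E d × ℝ => μ z.1 z.2) (f := fun r => (X r, r))
      hμ.hasFDerivAt (hXs.prodMk (hasDerivAt_id s))
  have h2 : HasDerivAt (fun r => μ (X s) r) _ s :=
    HasFDerivAt.comp_hasDerivAt s (l := fun z : E d × ℝ => μ z.1 z.2) (f := fun r => (X s, r))
      hμ.hasFDerivAt ((hasDerivAt_const s (X s)).prodMk (hasDerivAt_id s))
  have h3 : HasFDerivAt (fun y => μ y s) _ (X s) :=
    HasFDerivAt.comp (X s) (g := fun z : E d × ℝ => μ z.1 z.2) (f := fun y => (y, s))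
      hμ.hasFDerivAt ((hasFDerivAt_id (X s)).prodMk (hasFDerivAt_const s (X s)))
  rw [h2.deriv, h3.fderiv]
  convert h1 using 1
  simp only [ContinuousLinearMap.comp_apply, ContinuousLinearMap.prod_apply,
    ContinuousLinearMap.id_apply, _root_.zero_apply]
  rw [← map_sub]
  simp

end IsCharacteristic

/-! ### Transport along characteristics: propagation of bounds and stability. -/

section Iterates

variable {d p : ℕ} {u₀ : E d → ℝ} {f₀ : E d → E d} {c : E p →L[ℝ] E d} {ℓ : E d → E p → ℝ}
  {C₀ Cf Cl l₀ T M : ℝ} {a b : E d → ℝ → E p} {ν η μ μ' : E d → ℝ → E d}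

/-- The summand 1 in the constant absorbs the additive 1 in the growth bound of the action; the
Lipschitz estimate needs only the quotient. -/
theorem IsRegular.policy (hG : GrowthAssumption f₀ c ℓ Cf Cl l₀)
    (hS : SecondOrderAssumption f₀ c ℓ Cf Cl) (hl₀ : 0 < l₀) (hCl : 0 ≤ Cl)
    (hν : IsRegular T M ν)
    (ha : ∀ x, ∀ t ∈ Icc 0 T, IsArgmax (dynamics f₀ c) ℓ x (ν x t) (a x t)) :
    IsRegular T (1 + (Cl + Cf * M) / l₀) a where
  continuousOn x t ht := by
    refine tendsto_iff_norm_sub_tendsto_zero.2 ?_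
    have h1 : Filter.Tendsto (fun s => Cf / l₀ * ‖ν x s - ν x t‖) (nhdsWithin t (Icc 0 T))
        (nhds 0) := by
      simpa using (tendsto_iff_norm_sub_tendsto_zero.1 (hν.continuousOn x t ht)).const_mul (Cf / l₀)
    refine squeeze_zero' (Filter.Eventually.of_forall fun _ => norm_nonneg _) ?_ h1
    filter_upwards [self_mem_nhdsWithin] with s hs
    simpa using (ha x s hs).norm_sub_le hG hS hl₀ (ha x t ht)
  norm_le t ht x := by
    have hCf : 0 ≤ Cf := (norm_nonneg _).trans hG.norm_c_le
    refine ((ha x t ht).norm_le hG hl₀).trans ?_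
    calc 1 + Cf / l₀ * ‖ν x t‖ ≤ 1 + Cf / l₀ * (M * (1 + ‖x‖)) := by
          gcongr; exact hν.norm_le t ht x
      _ = 1 + Cf * M / l₀ * (1 + ‖x‖) := by ring
      _ ≤ (1 + ‖x‖) + (Cl + Cf * M) / l₀ * (1 + ‖x‖) := by
          gcongr <;> simp [hCl]
      _ = _ := by ring
  norm_sub_le t ht x y := by
    have hCf : 0 ≤ Cf := (norm_nonneg _).trans hG.norm_c_le
    refine ((ha x t ht).norm_sub_le hG hS hl₀ (ha y t ht)).trans ?_
    calc Cl / l₀ * ‖x - y‖ + Cf / l₀ * ‖ν x t - ν y t‖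
        ≤ Cl / l₀ * ‖x - y‖ + Cf / l₀ * (M * ‖x - y‖) := by
          gcongr; exact hν.norm_sub_le t ht x y
      _ = 0 * ‖x - y‖ + (Cl + Cf * M) / l₀ * ‖x - y‖ := by ring
      _ ≤ 1 * ‖x - y‖ + (Cl + Cf * M) / l₀ * ‖x - y‖ := by gcongr; exact zero_le_one
      _ = _ := by ring

theorem IsRegular.velocity (hG : GrowthAssumption f₀ c ℓ Cf Cl l₀) {A : ℝ}
    (ha : IsRegular T A a) :
    IsRegular T (Cf * (1 + A)) fun x t => dynamics f₀ c x (a x t) where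
  continuousOn x := continuousOn_const.add (c.continuous.comp_continuousOn (ha.continuousOn x))
  norm_le t ht x := by
    have hCf : 0 ≤ Cf := (norm_nonneg _).trans hG.norm_c_le
    calc ‖dynamics f₀ c x (a x t)‖ ≤ Cf * (1 + ‖x‖ + ‖a x t‖) := hG.f_le x _
      _ ≤ Cf * (1 + ‖x‖ + A * (1 + ‖x‖)) := by gcongr; exact ha.norm_le t ht x
      _ = _ := by ring
  norm_sub_le t ht x y := by
    have hCf : 0 ≤ Cf := (norm_nonneg _).trans hG.norm_c_le
    have h1 := hG.norm_sub_le x y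
    have h2 : ‖c (a x t - a y t)‖ ≤ Cf * (A * ‖x - y‖) :=
      (c.le_of_opNorm_le hG.norm_c_le _).trans (by gcongr; exact ha.norm_sub_le t ht x y)
    have h3 : dynamics f₀ c x (a x t) - dynamics f₀ c y (a y t)
        = (f₀ x - f₀ y) + c (a x t - a y t) := by
      simp only [dynamics, map_sub]; abel
    rw [h3]
    refine (norm_add_le _ _).trans ?_
    linarith

/-- The zeroth-order terms of the transport equation. -/
noncomputable def source (f₀ : E d → E d) (ℓ : E d → E p → ℝ) (a : E d → ℝ → E p)
    (ν : E d → ℝ → E d) (x : E d) (t : ℝ) : E d :=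
  ContinuousLinearMap.adjoint (fderiv ℝ f₀ x) (ν x t) + gradX ℓ x (a x t)

theorem norm_source_le (hG : GrowthAssumption f₀ c ℓ Cf Cl l₀) (hCl : 0 ≤ Cl) {A : ℝ}
    (hν : IsRegular T M ν) (ha : IsRegular T A a) {t : ℝ} (ht : t ∈ Icc 0 T) (x : E d) :
    ‖source f₀ ℓ a ν x t‖ ≤ (Cf * M + Cl * (1 + A)) * (1 + ‖x‖) := by
  have hCf : 0 ≤ Cf := (norm_nonneg _).trans hG.norm_c_le
  calc ‖source f₀ ℓ a ν x t‖ ≤ Cf * ‖ν x t‖ + Cl * (1 + ‖x‖ + ‖a x t‖) :=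
        (norm_add_le _ _).trans
          (add_le_add (norm_adjoint_apply_le (hG.norm_fderiv_le x) _) (hG.Dxl_le x _))
    _ ≤ Cf * (M * (1 + ‖x‖)) + Cl * (1 + ‖x‖ + A * (1 + ‖x‖)) := by
        gcongr
        · exact hν.norm_le t ht x
        · exact ha.norm_le t ht x
    _ = _ := by ring

/-- The 9 is 8 from the varying Jacobian acting on a linearly growing costate, plus 1 from the
Lipschitz variation of the costate. -/
theorem norm_source_sub_le (hG : GrowthAssumption f₀ c ℓ Cf Cl l₀)
    (hS : SecondOrderAssumption f₀ c ℓ Cf Cl) (hCl : 0 ≤ Cl) (hM : 0 ≤ M) {A : ℝ}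
    (hν : IsRegular T M ν) (ha : IsRegular T A a) {t : ℝ} (ht : t ∈ Icc 0 T) (x y : E d) :
    ‖source f₀ ℓ a ν x t - source f₀ ℓ a ν y t‖
      ≤ (9 * (Cf * M) + Cl * (1 + A)) * ‖x - y‖ := by
  have hCf : 0 ≤ Cf := (norm_nonneg _).trans hG.norm_c_le
  rw [source, source, add_sub_add_comm]
  calc _ ≤ (8 * Cf * M * ‖x - y‖ + Cf * ‖ν x t - ν y t‖)
        + (Cl * ‖x - y‖ + Cl * ‖a x t - a y t‖) :=
        (norm_add_le _ _).trans (add_le_add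
          (norm_adjoint_fderiv_sub_le hG hS hM (hν.norm_le t ht x)) (norm_gradX_sub_le hG hS _ _ _ _))
    _ ≤ (8 * Cf * M * ‖x - y‖ + Cf * (M * ‖x - y‖))
        + (Cl * ‖x - y‖ + Cl * (A * ‖x - y‖)) := by
        gcongr
        · exact hν.norm_sub_le t ht x y
        · exact ha.norm_sub_le t ht x y
    _ = _ := by ring

theorem InitialCostAssumption.norm_sub_le (h : InitialCostAssumption u₀ C₀) (x y : E d) :
    ‖gradient u₀ x - gradient u₀ y‖ ≤ C₀ * ‖x - y‖ := by
  have hd : Differentiable ℝ fun z => gradient u₀ z :=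
    (InnerProductSpace.toDual ℝ (E d)).symm.toContinuousLinearEquiv.differentiable.comp
      ((h.contDiff.fderiv_right (m := 1) (by norm_num)).differentiable (by norm_num))
  exact convex_univ.norm_image_sub_le_of_norm_fderiv_le (𝕜 := ℝ) (fun z _ => hd z)
    (fun z _ => h.hess_le z) (mem_univ y) (mem_univ x)

/-- Along the solution's own characteristics the gradient terms cancel. -/
theorem IsTransportSolution.hasDerivAt_comp
    (hμ : IsTransportSolution T u₀ (dynamics f₀ c) ℓ a ν μ) {X : ℝ → E d}
    (hX : IsCharacteristic T (fun x t => dynamics f₀ c x (a x t)) X) {s : ℝ} (hs : s ∈ Ioo 0 T) :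
    HasDerivAt (fun r => μ (X r) r) (source f₀ ℓ a ν (X s) s) s := by
  have := hX.hasDerivAt_comp hs (hμ.differentiableAt (X s) s hs)
  rwa [hμ.pde _ _ hs, fderiv_dynamics, add_assoc, add_sub_cancel_left] at this

theorem IsTransportSolution.continuousOn_comp
    (hμ : IsTransportSolution T u₀ (dynamics f₀ c) ℓ a ν μ) {V : E d → ℝ → E d} {X : ℝ → E d}
    (hX : IsCharacteristic T V X) : ContinuousOn (fun r => μ (X r) r) (Icc 0 T) :=
  hμ.continuousOn.comp (hX.continuousOn.prodMk continuousOn_id) fun _ hs => ⟨mem_univ _, hs⟩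

theorem norm_sub_le_of_hasDerivAt_Ioo {F : Type*} [NormedAddCommGroup F] [NormedSpace ℝ F]
    {h h' : ℝ → F} {C t : ℝ} (ht : 0 ≤ t) (hc : ContinuousOn h (Icc 0 t))
    (hd : ∀ s ∈ Ioo 0 t, HasDerivAt h (h' s) s) (hC : ∀ s ∈ Ioo 0 t, ‖h' s‖ ≤ C) :
    ‖h t - h 0‖ ≤ C * t := by
  have := norm_sub_le_integral_of_norm_deriv_le_of_le (B := fun _ => C) ht hc
    (fun s hs => (hd s hs).differentiableAt.differentiableWithinAt)
    (Filter.Eventually.of_forall fun s hs => by rw [(hd s hs).deriv]; exact hC s hs) (by simp)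
  simpa [mul_comm] using this

/-- On a short time interval, the bounds on the iterates are propagated. -/
theorem IsTransportSolution.isRegular (h₀ : InitialCostAssumption u₀ C₀)
    (hG : GrowthAssumption f₀ c ℓ Cf Cl l₀) (hS : SecondOrderAssumption f₀ c ℓ Cf Cl)
    (hC₀ : 0 ≤ C₀) (hCl : 0 ≤ Cl) (hM : 0 ≤ M) {A N : ℝ} (hA : 0 ≤ A)
    (hν : IsRegular T M ν) (ha : IsRegular T A a)
    (hV : IsRegular T N fun x t => dynamics f₀ c x (a x t)) (hN : 0 ≤ N) (hNT : N * T ≤ 1 / 2)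
    (hST : (9 * (Cf * M) + Cl * (1 + A)) * T ≤ 1 / 2)
    (hμ : IsTransportSolution T u₀ (dynamics f₀ c) ℓ a ν μ) :
    IsRegular T (2 * C₀ + 1) μ := by
  have hCf : 0 ≤ Cf := (norm_nonneg _).trans hG.norm_c_le
  refine ⟨fun x => ?_, fun t ht x => ?_, fun t ht x y => ?_⟩
  · exact hμ.continuousOn.comp (continuousOn_const.prodMk continuousOn_id)
      fun _ hs => ⟨mem_univ _, hs⟩
  · obtain ⟨X, hXt, hX⟩ := hV.exists_isCharacteristic hN hNT ht x
    have h0 : (0 : ℝ) ∈ Icc 0 T := ⟨le_rfl, ht.1.trans ht.2⟩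
    -- The growth bound of the source has `Cf * M` in place of `9 * (Cf * M)`; the larger constant
    -- is used so that one smallness condition serves growth and Lipschitz bounds alike.
    have h1 := norm_sub_le_of_hasDerivAt_Ioo
      (C := (9 * (Cf * M) + Cl * (1 + A)) * (2 * (1 + ‖x‖))) ht.1
      ((hμ.continuousOn_comp hX).mono (Icc_subset_Icc_right ht.2))
      (fun s hs => hμ.hasDerivAt_comp hX ⟨hs.1, hs.2.trans_le ht.2⟩)
      (fun s hs => by
        have hs' : s ∈ Icc 0 T := ⟨hs.1.le, hs.2.le.trans ht.2⟩
        have hg := hX.one_add_norm_le hV hN hNT hs' ht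
        rw [hXt] at hg
        refine (norm_source_le hG hCl hν ha hs' _).trans ?_
        have : 0 ≤ Cf * M := by positivity
        exact mul_le_mul (by linarith) hg (by positivity) (by positivity))
    have h2 : (9 * (Cf * M) + Cl * (1 + A)) * (2 * (1 + ‖x‖)) * t ≤ 1 * (1 + ‖x‖) := by
      calc _ ≤ (9 * (Cf * M) + Cl * (1 + A)) * (2 * (1 + ‖x‖)) * T := by gcongr; exact ht.2
        _ = 2 * ((9 * (Cf * M) + Cl * (1 + A)) * T) * (1 + ‖x‖) := by ring
        _ ≤ 2 * (1 / 2) * (1 + ‖x‖) := by gcongr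
        _ = _ := by ring
    -- The initial data contribute `2 * C₀` and the source at most 1. The sum does not involve `M`,
    -- which is why the iteration closes.
    have h3 : ‖μ (X 0) 0‖ ≤ 2 * C₀ * (1 + ‖x‖) := by
      have hg := hX.one_add_norm_le hV hN hNT h0 ht
      rw [hXt] at hg
      rw [hμ.initial]
      calc _ ≤ C₀ * (1 + ‖X 0‖) := h₀.grad_le _
        _ ≤ C₀ * (2 * (1 + ‖x‖)) := by gcongr
        _ = _ := by ring
    simp only [hXt] at h1
    have h4 := norm_le_norm_add_norm_sub (μ (X 0) 0) (μ x t)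
    rw [norm_sub_rev] at h4
    linarith
  · obtain ⟨X, hXt, hX⟩ := hV.exists_isCharacteristic hN hNT ht x
    obtain ⟨Y, hYt, hY⟩ := hV.exists_isCharacteristic hN hNT ht y
    have h0 : (0 : ℝ) ∈ Icc 0 T := ⟨le_rfl, ht.1.trans ht.2⟩
    have h1 := norm_sub_le_of_hasDerivAt_Ioo
      (C := (9 * (Cf * M) + Cl * (1 + A)) * (2 * ‖x - y‖)) ht.1
      (((hμ.continuousOn_comp hX).sub (hμ.continuousOn_comp hY)).mono (Icc_subset_Icc_right ht.2))
      (fun s hs => (hμ.hasDerivAt_comp hX ⟨hs.1, hs.2.trans_le ht.2⟩).sub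
        (hμ.hasDerivAt_comp hY ⟨hs.1, hs.2.trans_le ht.2⟩))
      (fun s hs => by
        have hs' : s ∈ Icc 0 T := ⟨hs.1.le, hs.2.le.trans ht.2⟩
        have hg := hX.norm_sub_le hY hV hN hNT hs' ht
        rw [hXt, hYt] at hg
        refine (norm_source_sub_le hG hS hCl hM hν ha hs' _ _).trans ?_
        gcongr)
    have h2 : (9 * (Cf * M) + Cl * (1 + A)) * (2 * ‖x - y‖) * t ≤ 1 * ‖x - y‖ := by
      calc _ ≤ (9 * (Cf * M) + Cl * (1 + A)) * (2 * ‖x - y‖) * T := by gcongr; exact ht.2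
        _ = 2 * ((9 * (Cf * M) + Cl * (1 + A)) * T) * ‖x - y‖ := by ring
        _ ≤ 2 * (1 / 2) * ‖x - y‖ := by gcongr
        _ = _ := by ring
    have h3 : ‖μ (X 0) 0 - μ (Y 0) 0‖ ≤ 2 * C₀ * ‖x - y‖ := by
      have hg := hX.norm_sub_le hY hV hN hNT h0 ht
      rw [hXt, hYt] at hg
      rw [hμ.initial, hμ.initial]
      calc _ ≤ C₀ * ‖X 0 - Y 0‖ := h₀.norm_sub_le _ _
        _ ≤ C₀ * (2 * ‖x - y‖) := by gcongr
        _ = _ := by ring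
    simp only [Pi.sub_apply, hXt, hYt] at h1
    have h4 := norm_le_norm_add_norm_sub (μ (X 0) 0 - μ (Y 0) 0) (μ x t - μ y t)
    rw [norm_sub_rev (μ (X 0) 0 - μ (Y 0) 0)] at h4
    linarith

/-- The difference of two consecutive iterates, followed along the characteristics of the newer
one, is controlled by the difference of the preceding iterates. -/
theorem IsTransportSolution.norm_sub_sq_le (hG : GrowthAssumption f₀ c ℓ Cf Cl l₀)
    (hS : SecondOrderAssumption f₀ c ℓ Cf Cl) (hl₀ : 0 < l₀) (hCl : 0 ≤ Cl) (hM : 0 ≤ M)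
    {K : ℝ} (hν : IsRegular T K ν) (hη : IsRegular T K η)
    (ha : ∀ x, ∀ t ∈ Icc 0 T, IsArgmax (dynamics f₀ c) ℓ x (ν x t) (a x t))
    (hb : ∀ x, ∀ t ∈ Icc 0 T, IsArgmax (dynamics f₀ c) ℓ x (η x t) (b x t))
    (hμ : IsTransportSolution T u₀ (dynamics f₀ c) ℓ a ν μ)
    (hμ' : IsTransportSolution T u₀ (dynamics f₀ c) ℓ b η μ') (hreg : IsRegular T M μ')
    {X : ℝ → E d} (hX : IsCharacteristic T (fun x t => dynamics f₀ c x (a x t)) X) {t : ℝ}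
    (ht : t ∈ Icc 0 T) :
    ‖μ (X t) t - μ' (X t) t‖ ^ 2 ≤ ((M * Cf + Cl) * (Cf / l₀) + Cf) ^ 2 * t *
      ∫ s in (0 : ℝ)..t, ‖ν (X s) s - η (X s) s‖ ^ 2 := by
  have hCf : 0 ≤ Cf := (norm_nonneg _).trans hG.norm_c_le
  set κ := (M * Cf + Cl) * (Cf / l₀) + Cf with hκ
  have hκ0 : 0 ≤ κ := by positivity
  have hsub : Icc (0 : ℝ) t ⊆ Icc 0 T := Icc_subset_Icc_right ht.2
  have hvc : ContinuousOn (fun s => ‖ν (X s) s - η (X s) s‖) (Icc 0 t) :=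
    ((hX.continuousOn_comp hν).sub (hX.continuousOn_comp hη)).norm.mono hsub
  have hderiv : ∀ s ∈ Ioo 0 t, ∃ w, HasDerivAt (fun r => μ (X r) r - μ' (X r) r) w s ∧
      ‖w‖ ≤ κ * ‖ν (X s) s - η (X s) s‖ := by
    intro s hs
    have hsT : s ∈ Ioo 0 T := ⟨hs.1, hs.2.trans_le ht.2⟩
    have hsI : s ∈ Icc 0 T := Ioo_subset_Icc_self hsT
    refine ⟨_, (hμ.hasDerivAt_comp hX hsT).sub
      (hX.hasDerivAt_comp hsT (hμ'.differentiableAt (X s) s hsT)), ?_⟩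
    set x := X s
    have hab : ‖a x s - b x s‖ ≤ Cf / l₀ * ‖ν x s - η x s‖ := by
      simpa using (ha x s hsI).norm_sub_le hG hS hl₀ (hb x s hsI)
    have hD : ‖fderiv ℝ (fun y => μ' y s) x‖ ≤ M :=
      norm_fderiv_le_of_lipschitz ℝ (C := ⟨M, hM⟩) <| LipschitzWith.of_dist_le_mul fun y z => by
        rw [dist_eq_norm, dist_eq_norm]; exact hreg.norm_sub_le s hsI y z
    have h1 : ‖fderiv ℝ (fun y => μ' y s) x (c (a x s - b x s))‖
        ≤ M * (Cf * ‖a x s - b x s‖) :=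
      (ContinuousLinearMap.le_of_opNorm_le _ hD _).trans
        (by gcongr; exact c.le_of_opNorm_le hG.norm_c_le _)
    have h2 := norm_adjoint_apply_le (hG.norm_fderiv_le x) (ν x s - η x s)
    have h3 : ‖gradX ℓ x (a x s) - gradX ℓ x (b x s)‖ ≤ Cl * ‖a x s - b x s‖ := by
      simpa using norm_gradX_sub_le hG hS x x (a x s) (b x s)
    -- The older iterate is followed along characteristics of the newer policy, so its gradient
    -- terms do not cancel. They leave `Dμ'` applied to `c (a - b)`, since the drifts `f₀` agree;
    -- this is where the Lipschitz bound on `μ'` enters.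
    have heq : source f₀ ℓ a ν x s - (deriv (fun r => μ' x r) s
          - fderiv ℝ (fun y => μ' y s) x (dynamics f₀ c x (a x s)))
        = fderiv ℝ (fun y => μ' y s) x (c (a x s - b x s))
          + ContinuousLinearMap.adjoint (fderiv ℝ f₀ x) (ν x s - η x s)
          + (gradX ℓ x (a x s) - gradX ℓ x (b x s)) := by
      rw [hμ'.pde x s hsT, fderiv_dynamics]
      simp only [source, dynamics, map_sub, map_add]
      abel
    rw [heq]
    calc _ ≤ M * (Cf * ‖a x s - b x s‖) + Cf * ‖ν x s - η x s‖ + Cl * ‖a x s - b x s‖ :=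
          norm_add₃_le.trans (add_le_add (add_le_add h1 h2) h3)
      _ = (M * Cf + Cl) * ‖a x s - b x s‖ + Cf * ‖ν x s - η x s‖ := by ring
      _ ≤ (M * Cf + Cl) * (Cf / l₀ * ‖ν x s - η x s‖) + Cf * ‖ν x s - η x s‖ := by gcongr
      _ = _ := by rw [hκ]; ring
  have hint : ‖(μ (X t) t - μ' (X t) t) - (μ (X 0) 0 - μ' (X 0) 0)‖
      ≤ ∫ s in (0 : ℝ)..t, κ * ‖ν (X s) s - η (X s) s‖ := by
    refine norm_sub_le_integral_of_norm_deriv_le_of_le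
      (f := fun r => μ (X r) r - μ' (X r) r) ht.1
      (((hμ.continuousOn_comp hX).sub (hμ'.continuousOn_comp hX)).mono hsub)
      (fun s hs => ?_) (Filter.Eventually.of_forall fun s hs => ?_) ?_
    · obtain ⟨w, hw, -⟩ := hderiv s hs
      exact hw.differentiableAt.differentiableWithinAt
    · obtain ⟨w, hw, hle⟩ := hderiv s hs
      rwa [hw.deriv]
    · exact ContinuousOn.intervalIntegrable (by rw [uIcc_of_le ht.1]; exact hvc.const_mul κ)
  rw [hμ.initial, hμ'.initial, sub_self, sub_zero, intervalIntegral.integral_const_mul] at hint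
  calc _ ≤ (κ * ∫ s in (0 : ℝ)..t, ‖ν (X s) s - η (X s) s‖) ^ 2 := by gcongr
    _ = κ ^ 2 * (∫ s in (0 : ℝ)..t, ‖ν (X s) s - η (X s) s‖) ^ 2 := by ring
    _ ≤ κ ^ 2 * (t * ∫ s in (0 : ℝ)..t, ‖ν (X s) s - η (X s) s‖ ^ 2) := by
        gcongr; exact sq_intervalIntegral_le ht.1 hvc
    _ = _ := by ring

end Iterates

/-! ### Weighted energies: integration over characteristics and over time. -/

section Energy

variable {d : ℕ} {T N α : ℝ} {V : E d → ℝ → E d}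

/-- Comparable values of `1 + ‖·‖` give comparable weights. Since `2 * α ≤ 2`, the constant `8 ^ 2 =
64` is uniform in `α`. -/
theorem div_weight_le {F : Type*} [NormedAddCommGroup F] (hα : α ∈ Ioo (0 : ℝ) 1) {y z : F}
    (h : 1 + ‖z‖ ≤ 2 * (1 + ‖y‖)) {r : ℝ} (hr : 0 ≤ r) :
    r / (1 + ‖y‖ ^ 2) ^ (2 * α) ≤ 64 * (r / (1 + ‖z‖ ^ 2) ^ (2 * α)) := by
  have h1 : 1 + ‖z‖ ^ 2 ≤ 8 * (1 + ‖y‖ ^ 2) := by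
    nlinarith [norm_nonneg y, norm_nonneg z, sq_nonneg (‖y‖ - 1)]
  have h2 : (1 + ‖z‖ ^ 2) ^ (2 * α) ≤ 64 * (1 + ‖y‖ ^ 2) ^ (2 * α) := by
    calc (1 + ‖z‖ ^ 2) ^ (2 * α) ≤ (8 * (1 + ‖y‖ ^ 2)) ^ (2 * α) :=
          Real.rpow_le_rpow (by positivity) h1 (by linarith [hα.1])
      _ = 8 ^ (2 * α) * (1 + ‖y‖ ^ 2) ^ (2 * α) :=
          Real.mul_rpow (by norm_num) (by positivity)
      _ ≤ 8 ^ (2 : ℝ) * (1 + ‖y‖ ^ 2) ^ (2 * α) := by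
          gcongr
          · norm_num
          · linarith [hα.2]
      _ = _ := by norm_num
  rw [← mul_div_assoc, div_le_div_iff₀ (by positivity) (by positivity)]
  calc r * (1 + ‖z‖ ^ 2) ^ (2 * α) ≤ r * (64 * (1 + ‖y‖ ^ 2) ^ (2 * α)) := by gcongr
    _ = _ := by ring

/-- Integrating over all characteristics through a given time slice. -/
theorem lintegral_comp_characteristic_le (hV : IsRegular T N V) (hN : 0 ≤ N)
    (hNT : N * T ≤ 1 / 2) {φ : E d → ℝ → ℝ}
    (hφ : ContinuousOn (fun z : E d × ℝ => φ z.1 z.2) (univ ×ˢ Icc 0 T)) {t : ℝ}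
    (ht : t ∈ Icc 0 T) {X : E d → ℝ → E d} (hXt : ∀ y, X y t = y)
    (hX : ∀ y, IsCharacteristic T V (X y)) :
    ∫⁻ y, ∫⁻ s in Icc 0 t, ENNReal.ofReal (φ (X y s) s)
      ≤ 2 ^ d * ∫⁻ s in Icc 0 t, ∫⁻ z, ENNReal.ofReal (φ z s) := by
  have hsub : Icc (0 : ℝ) t ⊆ Icc 0 T := Icc_subset_Icc_right ht.2
  have hlip : ∀ s ∈ Icc 0 T, LipschitzWith 2 fun y => X y s := fun s hs =>
    LipschitzWith.of_dist_le_mul fun y z => by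
      have := (hX y).norm_sub_le (hX z) hV hN hNT hs ht
      rw [hXt, hXt] at this
      simpa [dist_eq_norm] using this
  -- The lower distance bound is the one that controls the change of variables; the upper one above
  -- supplies continuity, hence measurability.
  have hanti : ∀ s ∈ Icc 0 T, AntilipschitzWith 2 fun y => X y s := fun s hs =>
    AntilipschitzWith.of_le_mul_dist fun y z => by
      have := (hX y).norm_sub_le (hX z) hV hN hNT ht hs
      rw [hXt, hXt] at this
      simpa [dist_eq_norm] using this
  have hXc : ContinuousOn (fun z : E d × ℝ => X z.1 z.2) (univ ×ˢ Icc 0 t) :=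
    continuousOn_prod_of_continuousOn_lipschitzOnWith (fun z : E d × ℝ => X z.1 z.2) 2
      (fun y _ => (hX y).continuousOn.mono hsub) fun s hs => (hlip s (hsub hs)).lipschitzOnWith
  have hcomp : ContinuousOn (fun z : E d × ℝ => φ (X z.1 z.2) z.2) (univ ×ˢ Icc 0 t) :=
    hφ.comp (hXc.prodMk continuousOn_snd) fun z hz => ⟨mem_univ _, hsub hz.2⟩
  have hmeas : AEMeasurable (Function.uncurry fun y s => ENNReal.ofReal (φ (X y s) s))
      ((volume : Measure (E d)).prod (volume.restrict (Icc 0 t))) := by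
    have h1 : (volume : Measure (E d)).prod (volume.restrict (Icc (0 : ℝ) t))
        = (volume.prod volume).restrict (univ ×ˢ Icc 0 t) := by
      rw [← Measure.prod_restrict, Measure.restrict_univ]
    rw [h1]
    exact (hcomp.aemeasurable (MeasurableSet.univ.prod measurableSet_Icc)).ennreal_ofReal
  rw [lintegral_lintegral_swap hmeas, ← lintegral_const_mul' _ _ (by simp)]
  refine setLIntegral_mono' measurableSet_Icc fun s hs => ?_
  have hφs : Continuous fun z => φ z s := by
    rw [← continuousOn_univ]
    exact hφ.comp (continuousOn_id.prodMk continuousOn_const) fun z _ => ⟨mem_univ _, hsub hs⟩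
  exact lintegral_comp_le_of_antilipschitzWith (hanti s (hsub hs))
    (hlip s (hsub hs)).continuous.measurable hφs.measurable.ennreal_ofReal

theorem continuousOn_weight {K : ℝ} {v : E d → ℝ → E d} (hv : IsRegular T K v) :
    ContinuousOn (fun z : E d × ℝ => ‖v z.1 z.2‖ ^ 2 / (1 + ‖z.1‖ ^ 2) ^ (2 * α))
      (univ ×ˢ Icc 0 T) := by
  refine (hv.continuousOn_prod.norm.pow 2).div ?_ fun z _ => by positivity
  exact ContinuousOn.rpow_const (by fun_prop) fun z _ => Or.inl (by positivity)

theorem IsCharacteristic.continuousOn_weight {K : ℝ} {v : E d → ℝ → E d} (hv : IsRegular T K v)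
    {X : ℝ → E d} (hX : IsCharacteristic T V X) :
    ContinuousOn (fun s => ‖v (X s) s‖ ^ 2 / (1 + ‖X s‖ ^ 2) ^ (2 * α)) (Icc 0 T) := by
  refine ((hX.continuousOn_comp hv).norm.pow 2).div ?_ fun z _ => by positivity
  exact ContinuousOn.rpow_const (continuousOn_const.add (hX.continuousOn.norm.pow 2))
    fun z _ => Or.inl (by positivity)

/-- The weight at the endpoint is moved under the time integral, since along a characteristic it
changes by at most a factor 64. -/
theorem weight_le_integral_of_characteristic (hα : α ∈ Ioo (0 : ℝ) 1) (hV : IsRegular T N V)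
    (hN : 0 ≤ N) (hNT : N * T ≤ 1 / 2) {v : E d → ℝ → E d} {K κ r : ℝ} (hv : IsRegular T K v)
    {X : ℝ → E d} (hX : IsCharacteristic T V X) {t : ℝ} (ht : t ∈ Icc 0 T)
    (hr : r ≤ κ ^ 2 * t * ∫ s in (0 : ℝ)..t, ‖v (X s) s‖ ^ 2) :
    r / (1 + ‖X t‖ ^ 2) ^ (2 * α) ≤ 64 * κ ^ 2 * T *
      ∫ s in (0 : ℝ)..t, ‖v (X s) s‖ ^ 2 / (1 + ‖X s‖ ^ 2) ^ (2 * α) := by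
  have hsub : Icc (0 : ℝ) t ⊆ Icc 0 T := Icc_subset_Icc_right ht.2
  have hvX : ContinuousOn (fun s => ‖v (X s) s‖ ^ 2) (Icc 0 t) :=
    ((hX.continuousOn_comp hv).norm.pow 2).mono hsub
  have hφX : ContinuousOn (fun s => ‖v (X s) s‖ ^ 2 / (1 + ‖X s‖ ^ 2) ^ (2 * α)) (Icc 0 t) :=
    (hX.continuousOn_weight hv).mono hsub
  have hφi : IntervalIntegrable (fun s => ‖v (X s) s‖ ^ 2 / (1 + ‖X s‖ ^ 2) ^ (2 * α))
      volume 0 t := ContinuousOn.intervalIntegrable (by rwa [uIcc_of_le ht.1])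
  have hvi : IntervalIntegrable (fun s => ‖v (X s) s‖ ^ 2) volume 0 t :=
    ContinuousOn.intervalIntegrable (by rwa [uIcc_of_le ht.1])
  have h0 : 0 ≤ ∫ s in (0 : ℝ)..t, ‖v (X s) s‖ ^ 2 / (1 + ‖X s‖ ^ 2) ^ (2 * α) :=
    intervalIntegral.integral_nonneg ht.1 fun s _ => by positivity
  have h1 : (∫ s in (0 : ℝ)..t, ‖v (X s) s‖ ^ 2) / (1 + ‖X t‖ ^ 2) ^ (2 * α)
      ≤ 64 * ∫ s in (0 : ℝ)..t, ‖v (X s) s‖ ^ 2 / (1 + ‖X s‖ ^ 2) ^ (2 * α) := by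
    rw [← intervalIntegral.integral_div, ← intervalIntegral.integral_const_mul]
    exact intervalIntegral.integral_mono_on ht.1 (hvi.div_const _) (hφi.const_mul _)
      fun s hs => div_weight_le hα (hX.one_add_norm_le hV hN hNT (hsub hs) ht) (by positivity)
  generalize (∫ s in (0 : ℝ)..t, ‖v (X s) s‖ ^ 2 / (1 + ‖X s‖ ^ 2) ^ (2 * α)) = I at h0 h1 ⊢
  generalize (∫ s in (0 : ℝ)..t, ‖v (X s) s‖ ^ 2) = J at hr h1
  have ht0 := ht.1
  calc r / (1 + ‖X t‖ ^ 2) ^ (2 * α) ≤ (κ ^ 2 * t * J) / (1 + ‖X t‖ ^ 2) ^ (2 * α) := by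
        gcongr
    _ = κ ^ 2 * t * (J / (1 + ‖X t‖ ^ 2) ^ (2 * α)) := by ring
    _ ≤ κ ^ 2 * t * (64 * I) := by gcongr
    _ ≤ κ ^ 2 * T * (64 * I) := by gcongr; exact ht.2
    _ = _ := by ring

/-- If `w` is controlled by the integral of `v` along characteristics, then so are the weighted
energies of the time slices. -/
theorem lintegral_weight_le_of_characteristic (hα : α ∈ Ioo (0 : ℝ) 1) (hV : IsRegular T N V)
    (hN : 0 ≤ N) (hNT : N * T ≤ 1 / 2) {v w : E d → ℝ → E d} {K κ : ℝ} (hv : IsRegular T K v)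
    (hw : ∀ X, IsCharacteristic T V X → ∀ t ∈ Icc 0 T,
      ‖w (X t) t‖ ^ 2 ≤ κ ^ 2 * t * ∫ s in (0 : ℝ)..t, ‖v (X s) s‖ ^ 2)
    {t : ℝ} (ht : t ∈ Icc 0 T) :
    ∫⁻ x, ENNReal.ofReal (‖w x t‖ ^ 2 / (1 + ‖x‖ ^ 2) ^ (2 * α))
      ≤ ENNReal.ofReal (64 * κ ^ 2 * T) * (2 ^ d * ∫⁻ s in Icc 0 t,
        ∫⁻ x, ENNReal.ofReal (‖v x s‖ ^ 2 / (1 + ‖x‖ ^ 2) ^ (2 * α))) := by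
  have hsub : Icc (0 : ℝ) t ⊆ Icc 0 T := Icc_subset_Icc_right ht.2
  have hT : 0 ≤ T := ht.1.trans ht.2
  -- The characteristic through each point `(y, t)` is chosen arbitrarily; regular dependence on `y`
  -- follows from the Gronwall bound.
  choose X hXt hX using hV.exists_isCharacteristic hN hNT ht
  have hflow := lintegral_comp_characteristic_le hV hN hNT
    (φ := fun z s => ‖v z s‖ ^ 2 / (1 + ‖z‖ ^ 2) ^ (2 * α)) (continuousOn_weight hv) ht hXt hX
  refine le_trans ?_ (mul_le_mul_right hflow _)
  rw [← lintegral_const_mul' _ _ ENNReal.ofReal_ne_top]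
  refine lintegral_mono fun y => ?_
  have hreal := weight_le_integral_of_characteristic hα hV hN hNT hv (hX y) ht
    (hw (X y) (hX y) t ht)
  have hφX : ContinuousOn (fun s => ‖v (X y s) s‖ ^ 2 / (1 + ‖X y s‖ ^ 2) ^ (2 * α)) (Icc 0 t) :=
    ((hX y).continuousOn_weight hv).mono hsub
  have hlin := ofReal_integral_eq_lintegral_ofReal (hφX.integrableOn_Icc (μ := volume))
    (Filter.Eventually.of_forall fun s => by positivity)
  rw [hXt, intervalIntegral.integral_of_le ht.1, ← integral_Icc_eq_integral_Ioc] at hreal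
  refine (ENNReal.ofReal_le_ofReal hreal).trans_eq ?_
  rw [ENNReal.ofReal_mul (by positivity), hlin]

/-- Integration in time of the slice-wise energy bounds. -/
theorem lintegral_exp_mul_le_of_slice_le {γ : ℝ} (hγ : 0 ≤ γ) {A B : ℝ → ℝ≥0∞}
    {C : ℝ≥0∞} (h : ∀ t ∈ Icc 0 T, B t ≤ C * ∫⁻ s in Icc 0 t, A s) :
    ∫⁻ t in Icc 0 T, ENNReal.ofReal (Real.exp (-γ * t)) * B t
      ≤ C * ENNReal.ofReal T * ∫⁻ t in Icc 0 T, ENNReal.ofReal (Real.exp (-γ * t)) * A t := by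
  calc ∫⁻ t in Icc 0 T, ENNReal.ofReal (Real.exp (-γ * t)) * B t
      ≤ ∫⁻ t in Icc 0 T, C * ∫⁻ s in Icc 0 T, ENNReal.ofReal (Real.exp (-γ * s)) * A s := by
        refine setLIntegral_mono' measurableSet_Icc fun t ht => ?_
        calc _ ≤ ENNReal.ofReal (Real.exp (-γ * t)) * (C * ∫⁻ s in Icc 0 t, A s) := by
              gcongr; exact h t ht
          _ = C * ∫⁻ s in Icc 0 t, ENNReal.ofReal (Real.exp (-γ * t)) * A s := by
              rw [lintegral_const_mul' _ _ ENNReal.ofReal_ne_top, mul_left_comm]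
          _ ≤ C * ∫⁻ s in Icc 0 t, ENNReal.ofReal (Real.exp (-γ * s)) * A s := by
              gcongr C * ?_
              -- For `s ≤ t` and `γ ≥ 0` the exponential weight at `t` is at most the one at `s`.
              -- Only this monotonicity is used; the smallness comes from the length `T` of the
              -- outer integral.
              refine setLIntegral_mono' measurableSet_Icc fun s hs => ?_
              gcongr ENNReal.ofReal (Real.exp ?_) * _
              have := mul_le_mul_of_nonneg_left hs.2 hγ
              linarith
          _ ≤ _ := by
              gcongr C * ?_
              exact lintegral_mono_set (Icc_subset_Icc_right ht.2)
    _ = _ := by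
        rw [setLIntegral_const, Real.volume_Icc, sub_zero]
        ring

end Energy

/-! ### Uniform bounds for all iterates, contraction, and choice of `T₀`. -/

section Main

variable {d p : ℕ} {u₀ : E d → ℝ} {f₀ : E d → E d} {c : E p →L[ℝ] E d} {ℓ : E d → E p → ℝ}
  {C₀ Cf Cl l₀ T : ℝ} {lam : ℕ → E d → ℝ → E d} {a : ℕ → E d → ℝ → E p}

theorem IsIteration.isRegular (h₀ : InitialCostAssumption u₀ C₀)
    (hG : GrowthAssumption f₀ c ℓ Cf Cl l₀) (hS : SecondOrderAssumption f₀ c ℓ Cf Cl)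
    (hl₀ : 0 < l₀) (hC₀ : 0 ≤ C₀) (hCl : 0 ≤ Cl) {M A : ℝ} (hM : M = 2 * C₀ + 1)
    (hA : A = 1 + (Cl + Cf * M) / l₀) (hNT : Cf * (1 + A) * T ≤ 1 / 2)
    (hST : (9 * (Cf * M) + Cl * (1 + A)) * T ≤ 1 / 2)
    (hit : IsIteration T u₀ (dynamics f₀ c) ℓ lam a) (k : ℕ) : IsRegular T M (lam k) := by
  have hCf : 0 ≤ Cf := (norm_nonneg _).trans hG.norm_c_le
  have hM0 : 0 ≤ M := by rw [hM]; positivity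
  have hA0 : 0 ≤ A := by rw [hA]; positivity
  induction k with
  | zero =>
    refine ⟨fun x => ?_, fun t ht x => ?_, fun t ht x y => ?_⟩
    · exact continuousOn_const.congr fun t ht => hit.start x t ht
    · rw [hit.start x t ht, hM]
      refine (h₀.grad_le x).trans ?_
      gcongr
      linarith
    · rw [hit.start x t ht, hit.start y t ht, hM]
      refine (h₀.norm_sub_le x y).trans ?_
      gcongr
      linarith
  | succ k ih =>
    have ha : IsRegular T A (a k) := hA ▸ ih.policy hG hS hl₀ hCl (hit.policy k)
    rw [hM]
    exact (hit.step k).isRegular h₀ hG hS hC₀ hCl hM0 hA0 ih ha (ha.velocity hG)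
      (by positivity) hNT hST

/-- On a short time interval, the policy iteration contracts the weighted error. -/
theorem IsIteration.err_succ_le (h₀ : InitialCostAssumption u₀ C₀)
    (hG : GrowthAssumption f₀ c ℓ Cf Cl l₀) (hS : SecondOrderAssumption f₀ c ℓ Cf Cl)
    (hl₀ : 0 < l₀) (hC₀ : 0 ≤ C₀) (hCl : 0 ≤ Cl) {M A κ : ℝ} (hM : M = 2 * C₀ + 1)
    (hA : A = 1 + (Cl + Cf * M) / l₀) (hκ : κ = (M * Cf + Cl) * (Cf / l₀) + Cf)
    (hT : 0 ≤ T) (hNT : Cf * (1 + A) * T ≤ 1 / 2)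
    (hST : (9 * (Cf * M) + Cl * (1 + A)) * T ≤ 1 / 2)
    (hκT : 64 * κ ^ 2 * T * (2 ^ d * T) ≤ 1 / 2) {α γ : ℝ} (hα : α ∈ Ioo (0 : ℝ) 1) (hγ : 0 ≤ γ)
    (hit : IsIteration T u₀ (dynamics f₀ c) ℓ lam a) (k : ℕ) :
    err T α γ lam (k + 2) ≤ 2⁻¹ * err T α γ lam (k + 1) := by
  have hCf : 0 ≤ Cf := (norm_nonneg _).trans hG.norm_c_le
  have hM0 : 0 ≤ M := by rw [hM]; positivity
  have hA0 : 0 ≤ A := by rw [hA]; positivity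
  have hreg := hit.isRegular h₀ hG hS hl₀ hC₀ hCl hM hA hNT hST
  have ha : IsRegular T A (a (k + 1)) :=
    hA ▸ (hreg (k + 1)).policy hG hS hl₀ hCl (hit.policy (k + 1))
  have hslice := fun t (ht : t ∈ Icc 0 T) =>
    lintegral_weight_le_of_characteristic hα (ha.velocity hG) (by positivity) hNT
      ((hreg (k + 1)).sub (hreg k)) (w := fun x t => lam (k + 2) x t - lam (k + 1) x t) (κ := κ)
      (fun X hX s hs => hκ ▸ (hit.step (k + 1)).norm_sub_sq_le hG hS hl₀ hCl hM0 (hreg (k + 1))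
        (hreg k) (hit.policy (k + 1)) (hit.policy k) (hit.step k) (hreg (k + 1)) hX hs) ht
  have hmain := lintegral_exp_mul_le_of_slice_le hγ
    (A := fun t => ∫⁻ x, ENNReal.ofReal
      (‖lam (k + 1) x t - lam k x t‖ ^ 2 / (1 + ‖x‖ ^ 2) ^ (2 * α)))
    (C := ENNReal.ofReal (64 * κ ^ 2 * T) * 2 ^ d)
    fun t ht => (hslice t ht).trans_eq (mul_assoc _ _ _).symm
  refine hmain.trans ?_
  have hconst : ENNReal.ofReal (64 * κ ^ 2 * T) * 2 ^ d * ENNReal.ofReal T ≤ 2⁻¹ := by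
    have h2 : (2 : ℝ≥0∞) ^ d = ENNReal.ofReal (2 ^ d) := by
      rw [ENNReal.ofReal_pow (by norm_num)]; simp
    rw [h2, ← ENNReal.ofReal_mul (by positivity), ← ENNReal.ofReal_mul (by positivity),
      mul_assoc]
    refine (ENNReal.ofReal_le_ofReal hκT).trans_eq ?_
    rw [one_div, ENNReal.ofReal_inv_of_pos (by norm_num)]
    simp
  exact mul_le_mul_left hconst _

end Main

end PILambda

theorem theorem3 (d p : ℕ) (C₀ Cf Cl l₀ : ℝ) (hl₀ : 0 < l₀) :
    ∃ T₀ : ℝ, 0 < T₀ ∧ ∃ γ₀ : ℝ, 0 < γ₀ ∧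
      ∀ (u₀ : PILambda.E d → ℝ) (f₀ : PILambda.E d → PILambda.E d)
        (c : PILambda.E p →L[ℝ] PILambda.E d) (ℓ : PILambda.E d → PILambda.E p → ℝ),
        PILambda.InitialCostAssumption u₀ C₀ →
        PILambda.GrowthAssumption f₀ c ℓ Cf Cl l₀ →
        PILambda.SecondOrderAssumption f₀ c ℓ Cf Cl →
        ∀ α ∈ Set.Ioo (0 : ℝ) 1, ∀ T : ℝ, 0 < T → T ≤ T₀ → ∀ γ : ℝ, γ₀ ≤ γ →
        ∀ (lam : ℕ → PILambda.E d → ℝ → PILambda.E d) (a : ℕ → PILambda.E d → ℝ → PILambda.E p),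
          PILambda.IsIteration T u₀ (PILambda.dynamics f₀ c) ℓ lam a →
          (∀ k : ℕ, 1 ≤ k → PILambda.err T α γ lam k ≤
              (2⁻¹ : ℝ≥0∞) ^ (k - 1) * PILambda.err T α γ lam 1) ∧
          (PILambda.err T α γ lam 1 < ⊤ →
            ∃ C : ℝ≥0, ∀ k : ℕ, 1 ≤ k → PILambda.err T α γ lam k ≤
              (C : ℝ≥0∞) * (2⁻¹ : ℝ≥0∞) ^ k) := by
  obtain ⟨M, hM⟩ : ∃ M, M = 2 * C₀ + 1 := ⟨_, rfl⟩
  obtain ⟨A, hA⟩ : ∃ A, A = 1 + (Cl + Cf * M) / l₀ := ⟨_, rfl⟩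
  obtain ⟨κ, hκ⟩ : ∃ κ, κ = (M * Cf + Cl) * (Cf / l₀) + Cf := ⟨_, rfl⟩
  -- `S` majorises every constant that must become small after multiplication by `T`. Absolute
  -- values are taken because `T₀` is fixed before the hypotheses that force `C₀`, `Cf` and `Cl` to
  -- be nonnegative.
  obtain ⟨S, hS⟩ : ∃ S, S = 1 + |Cf * (1 + A)| + |9 * (Cf * M) + Cl * (1 + A)|
    + 64 * κ ^ 2 * 2 ^ d := ⟨_, rfl⟩
  have hκ0 : 0 ≤ 64 * κ ^ 2 * 2 ^ d := by positivity
  have hS1 : 1 ≤ S := by rw [hS, add_assoc, add_assoc]; exact le_add_of_nonneg_right (by positivity)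
  -- Any positive `γ₀` would do, as only `γ ≥ 0` is needed.
  refine ⟨1 / (2 * S), by positivity, 1, one_pos, ?_⟩
  intro u₀ f₀ c ℓ h₀ hG hS' α hα T hT hTT γ hγ lam a hit
  have hST : S * T ≤ 1 / 2 := by
    calc S * T ≤ S * (1 / (2 * S)) := by gcongr
      _ = 1 / 2 := by field_simp
  have hle : ∀ r, r ≤ S → r * T ≤ 1 / 2 := fun r hr =>
    (mul_le_mul_of_nonneg_right hr hT.le).trans hST
  have hN := le_abs_self (Cf * (1 + A))
  have hQ := le_abs_self (9 * (Cf * M) + Cl * (1 + A))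
  have hN0 := abs_nonneg (Cf * (1 + A))
  have hQ0 := abs_nonneg (9 * (Cf * M) + Cl * (1 + A))
  -- Allows one factor of `T` to be dropped from the quadratic condition on `κ`, making it linear in
  -- `T`.
  have hT1 : T ≤ 1 := by linarith [hle 1 hS1]
  have hC₀ : 0 ≤ C₀ := (norm_nonneg _).trans (h₀.hess_le 0)
  have hCl : 0 ≤ Cl := by simpa using (abs_nonneg _).trans (hG.l_le 0 0)
  have hκT : 64 * κ ^ 2 * T * (2 ^ d * T) ≤ 1 / 2 := by
    calc 64 * κ ^ 2 * T * (2 ^ d * T) = 64 * κ ^ 2 * 2 ^ d * T * T := by ring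
      _ ≤ 64 * κ ^ 2 * 2 ^ d * T * 1 := by gcongr
      _ ≤ _ := by rw [mul_one]; exact hle _ (by linarith)
  have hstep := hit.err_succ_le h₀ hG hS' hl₀ hC₀ hCl hM hA hκ hT.le (hle _ (by linarith))
    (hle _ (by linarith)) hκT hα (zero_le_one.trans hγ)
  have hgeom : ∀ k : ℕ, PILambda.err T α γ lam (k + 1) ≤
      (2⁻¹ : ℝ≥0∞) ^ k * PILambda.err T α γ lam 1 := fun k => by
    induction k with
    | zero => simp
    | succ k ih =>
      calc _ ≤ 2⁻¹ * PILambda.err T α γ lam (k + 1) := hstep k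
        _ ≤ 2⁻¹ * ((2⁻¹ : ℝ≥0∞) ^ k * PILambda.err T α γ lam 1) := by gcongr
        _ = _ := by rw [pow_succ' _ k, mul_assoc]
  refine ⟨fun k hk => ?_, fun hfin => ?_⟩
  · obtain ⟨j, rfl⟩ := Nat.exists_eq_add_of_le' hk
    exact hgeom j
  -- The factor 2 accounts for the shift from exponent `k - 1` to `k`.
  · refine ⟨2 * (PILambda.err T α γ lam 1).toNNReal, fun k hk => ?_⟩
    obtain ⟨j, rfl⟩ := Nat.exists_eq_add_of_le' hk
    refine (hgeom j).trans_eq ?_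
    rw [ENNReal.coe_mul, ENNReal.coe_toNNReal hfin.ne, pow_succ]
    calc (2⁻¹ : ℝ≥0∞) ^ j * PILambda.err T α γ lam 1
        = (2⁻¹ : ℝ≥0∞) ^ j * PILambda.err T α γ lam 1 * (2 * 2⁻¹) := by
          rw [ENNReal.mul_inv_cancel (by norm_num) (by norm_num), mul_one]
      _ = _ := by push_cast; ring
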